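/- Let $d\ge 2$ be an integer and $\mathbb{T}^d=(\mathbb{R}/2\pi\mathbb{Z})^d$, with Fourier basis $e_k(x)=(2\pi)^{-d/2}e^{ik\cdot x}$, $k\in\mathbb{Z}^d$. For real $m$ let $\mathbb{H}^m$ be the Sobolev space of real vector fields $v=\sum_k v_ke_k$ on $\mathbb{T}^d$ with zero mean, zero divergence and $\sum_{k\ne0}|k|^{2m}|v_k|^2<\infty$, with inner product $\langle v|w\rangle_m=\sum_{k\neq 0}|k|^{2m}\,\overline{v_k}\cdot w_k$ and norm $\|v\|_m=\sqrt{\langle v|v\rangle_m}$. Let $\mathcal{P}(v,w)=\mathfrak{L}(v\cdot\partial w)$, where $(v\cdot\partial w)_s=\sum_r v_r\,\partial_r w_s$ and $\mathfrak{L}$ is the Leray projection onto divergence free fields. For real $p\ge n>d/2+1$ let $G_{pn}=G_{pnd}$ be the sharp (i.e. minimum) constant such that $$|\langle\mathcal{P}(v,w)|w\rangle_p|\le\tfrac12\,G_{pn}\,\big(\|v\|_p\|w\|_n+\|v\|_n\|w\|_p\big)\|w\|_p\qquad\text{for all }v\in\mathbb{H}^p,\ w\in\mathbb{H}^{p+1}.$$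 Put $$\Sigma_{pn}=\Big(1+2\sqrt{\tfrac np}+\tfrac{5n}{4p}\Big)^p+\Big(1+2\sqrt{\tfrac np}+\tfrac{2n}{p}\Big)^p+\tfrac12\Big(\tfrac np\Big)^p,$$ $$\Upsilon_{pn}=\Big(1+2\sqrt{\tfrac np}+\tfrac{2n}{p}\Big)^n+\frac{1}{2^{2p-2n}}\Big(1+2\sqrt{\tfrac np}+\tfrac{5n}{4p}\Big)^n+\tfrac12\Big(\tfrac np\Big)^n,$$ $$D_{pn}=\Big(\big(1+\sqrt{\tfrac np}\big)^p\,\Upsilon_{pn}^{1/2}+\big(1+\sqrt{\tfrac np}\big)^n\,\Sigma_{pn}^{1/2}\Big)\Sigma_{pn}^{1/2},\qquad c_n=\frac{e^{9n/8}}{\big(1+e^{n/8}\sqrt{1+e^{3n/4}}\big)\sqrt{1+e^{3n/4}}}.$$ (i) Let $d\ge3$. For all real $p\ge n>d/2+1$ one has $G_{pn}\ge G^{\langle-\rangle}_{pn}$, where $$G^{\langle-\rangle}_{pn}=\frac{\sqrt2}{(2\pi)^{d/2}}\Big(\frac np\Big)^{n/2}\,\frac{\big(1+\frac{n}{4p}\big)^p\,2^p+\big(1-\frac1{2^p}\big)\big(1+\frac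 np\big)^p-\big(\frac np\big)^p}{D_{pn}}.$$ (ii) Let $d\ge3$. For fixed $n>d/2+1$ and $p\to+\infty$, $$G^{\langle-\rangle}_{pn}\sim\frac{\sqrt2}{(2\pi)^{d/2}}\,c_n\Big(\frac np\Big)^{n/2}\frac{2^p}{e^{2\sqrt{np}}},\qquad (G^{\langle-\rangle}_{pn})^{1/p}\to2.$$ (iii) Let $d=2$. For all real $p\ge n>2$ one has $G_{pn}\ge G^{\langle-\rangle}_{pn}$, where $$G^{\langle-\rangle}_{pn}=\frac{\big(\frac np\big)^{n/2+1}}{\sqrt2\,\pi\sqrt{\big(1+\frac np\big)\big(1+\frac{4n}p\big)}}\cdot\frac{15\big(1+\frac n{4p}\big)^{p-1}2^{p-2}+\big(1+\frac np\big)^{p-1}\Big(2\sqrt{1+\frac{4n}p}-\frac3{2^{p-1}}\Big)-\sqrt{1+\frac{4n}p}\,\big(\frac np\big)^{p-1}}{D_{pn}}.$$ (iv) Let $d=2$. For fixed $n>2$ and $p\to+\infty$, $$G^{\langle-\rangle}_{pn}\sim\frac{15}{4\sqrt2\,\pi}\,c_n\Big(\frac np\Big)^{n/2+1}\frac{2^p}{e^{2\sqrt{np}}},\qquad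 (G^{\langle-\rangle}_{pn})^{1/p}\to2.$$ -/

import Mathlib

open MeasureTheory Filter Topology Asymptotics
open scoped ComplexConjugate

noncomputable section

namespace KatoTorus

instance twoPiPos : Fact (0 < 2 * Real.pi) := ⟨Real.two_pi_pos⟩

/-- The torus `(ℝ / 2πℤ)^d`; its `volume` has total mass `(2π)^d`. -/
abbrev Torus (d : ℕ) : Type := Fin d → AddCircle (2 * Real.pi)

/-- Real vector fields on the torus (representatives; only their classes modulo equality
almost everywhere matter below). -/
abbrev VField (d : ℕ) : Type := Torus d → EuclideanSpace ℝ (Fin d)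

/-- Families of vectors of `ℂ^d` indexed by the lattice `ℤ^d`. -/
abbrev CoeffFamily (d : ℕ) : Type := (Fin d → ℤ) → EuclideanSpace ℂ (Fin d)

/-- The lattice point `k`, seen as a vector of `ℂ^d`. -/
def latVec {d : ℕ} (k : Fin d → ℤ) : EuclideanSpace ℂ (Fin d) :=
  WithLp.toLp 2 fun s => (k s : ℂ)

/-- The Euclidean length `|k|` of a lattice point. -/
def latNorm {d : ℕ} (k : Fin d → ℤ) : ℝ := Real.sqrt (∑ s, (k s : ℝ) ^ 2)

/-- The normalized exponential `e_k(x) = (2π)^{-d/2} e^{i k·x}`. -/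
def expMode {d : ℕ} (k : Fin d → ℤ) (x : Torus d) : ℂ :=
  (((2 * Real.pi) ^ (-((d : ℝ) / 2)) : ℝ) : ℂ) * ∏ s, fourier (k s) (x s)

/-- The Fourier coefficients `v_k ∈ ℂ^d` of a vector field: `(v_k)_s = ∫ conj(e_k) v_s`. -/
def coeff {d : ℕ} (v : VField d) : CoeffFamily d := fun k =>
  WithLp.toLp 2 fun s => ∫ x : Torus d, conj (expMode k x) * ((v x s : ℝ) : ℂ)

/-- Membership in the Sobolev space of order `m`, for `m ≥ 0` (so that its elements are square
integrable): zero mean, zero divergence, and `∑ |k|^{2m} |v_k|^2 < ∞`. -/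
structure MemSobolev {d : ℕ} (m : ℝ) (v : VField d) : Prop where
  memLp : MemLp v 2 volume
  mean_zero : coeff v 0 = 0
  div_free : ∀ k : Fin d → ℤ, ∑ s, (k s : ℂ) * coeff v k s = 0
  summable : Summable fun k : Fin d → ℤ => latNorm k ^ (2 * m) * ‖coeff v k‖ ^ 2

/-- `⟨a | b⟩_m = ∑ |k|^{2m} conj(a_k)·b_k`, in terms of Fourier coefficients. -/
def sobolevInner {d : ℕ} (m : ℝ) (a b : CoeffFamily d) : ℂ :=
  ∑' k : Fin d → ℤ, ((latNorm k ^ (2 * m) : ℝ) : ℂ) * inner ℂ (a k) (b k)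

/-- The Sobolev norm `‖v‖_m`. -/
def sobolevNorm {d : ℕ} (m : ℝ) (v : VField d) : ℝ :=
  Real.sqrt (∑' k : Fin d → ℤ, latNorm k ^ (2 * m) * ‖coeff v k‖ ^ 2)

/-- `D r` is, for each `r`, the distributional derivative `∂_r w`, and is square integrable
(the derivative is tested against the exponentials, i.e. `(∂_r w)_k = i k_r w_k`). -/
def IsGradient {d : ℕ} (w : VField d) (D : Fin d → VField d) : Prop :=
  ∀ r, MemLp (D r) 2 volume ∧
    ∀ k : Fin d → ℤ, coeff (D r) k = (Complex.I * (k r : ℂ)) • coeff w k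

/-- The vector field `v·∂w = ∑_r v_r ∂_r w`, where `D r = ∂_r w`. -/
def convective {d : ℕ} (v : VField d) (D : Fin d → VField d) : VField d :=
  fun x => ∑ r, v x r • D r x

/-- The Leray projection at the frequency `k`: the orthogonal projection of `ℂ^d` onto the
orthogonal complement of `k`. -/
def leray {d : ℕ} (k : Fin d → ℤ) (c : EuclideanSpace ℂ (Fin d)) : EuclideanSpace ℂ (Fin d) :=
  ((Submodule.span ℂ {latVec k})ᗮ).starProjection c

/-- Fourier coefficients of the Navier-Stokes bilinear map `𝒫(v, w) = 𝔏(v·∂w)`,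
where `D r = ∂_r w`. -/
def nsBilinear {d : ℕ} (v : VField d) (D : Fin d → VField d) : CoeffFamily d :=
  fun k => leray k (coeff (convective v D) k)

/-- `C` is an admissible constant in the tame Kato inequality of orders `p, n`. -/
def KatoBound (d : ℕ) (p n C : ℝ) : Prop :=
  ∀ (v w : VField d) (D : Fin d → VField d),
    MemSobolev p v → MemSobolev (p + 1) w → IsGradient w D →
      ‖sobolevInner p (nsBilinear v D) (coeff w)‖ ≤
        1 / 2 * C * (sobolevNorm p v * sobolevNorm n w + sobolevNorm n v * sobolevNorm p w)
          * sobolevNorm p w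

/-- The sharp constant `G_{pn}` in dimension `d`: the infimum (in the extended reals) of the
admissible constants. -/
def sharpG (d : ℕ) (p n : ℝ) : EReal :=
  sInf (Real.toEReal '' {C : ℝ | KatoBound d p n C})

/-- The quantity `Σ_{pn}`. -/
def sigmaFn (p n : ℝ) : ℝ :=
  (1 + 2 * √(n / p) + 5 * n / (4 * p)) ^ p + (1 + 2 * √(n / p) + 2 * n / p) ^ p
    + 1 / 2 * (n / p) ^ p

/-- The quantity `Υ_{pn}`. -/
def upsilonFn (p n : ℝ) : ℝ :=
  (1 + 2 * √(n / p) + 2 * n / p) ^ n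
    + 1 / 2 ^ (2 * p - 2 * n) * (1 + 2 * √(n / p) + 5 * n / (4 * p)) ^ n
    + 1 / 2 * (n / p) ^ n

/-- The common denominator of the two lower bounds. -/
def denomFn (p n : ℝ) : ℝ :=
  ((1 + √(n / p)) ^ p * √(upsilonFn p n) + (1 + √(n / p)) ^ n * √(sigmaFn p n))
    * √(sigmaFn p n)

/-- The explicit lower bound in dimension `d ≥ 3`. -/
def lowerG (d : ℕ) (p n : ℝ) : ℝ :=
  √2 / (2 * Real.pi) ^ ((d : ℝ) / 2) * (n / p) ^ (n / 2) *
    (((1 + n / (4 * p)) ^ p * 2 ^ p + (1 - 1 / 2 ^ p) * (1 + n / p) ^ p - (n / p) ^ p)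
      / denomFn p n)

/-- The explicit lower bound in dimension `2`. -/
def lowerGTwo (p n : ℝ) : ℝ :=
  (n / p) ^ (n / 2 + 1) / (√2 * Real.pi * √((1 + n / p) * (1 + 4 * n / p))) *
    ((15 * (1 + n / (4 * p)) ^ (p - 1) * 2 ^ (p - 2)
        + (1 + n / p) ^ (p - 1) * (2 * √(1 + 4 * n / p) - 3 / 2 ^ (p - 1))
        - √(1 + 4 * n / p) * (n / p) ^ (p - 1))
      / denomFn p n)

/-- The `n`-dependent factor common to the two asymptotic expansions. -/
def asympConst (n : ℝ) : ℝ :=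
  Real.exp (9 * n / 8) /
    ((1 + Real.exp (n / 8) * √(1 + Real.exp (3 * n / 4))) * √(1 + Real.exp (3 * n / 4)))

end KatoTorus

end

/-!
An admissible constant `C` is bounded below by the ratio of the two sides of the inequality for any
pair of trial fields, so that each lower bound only needs one good pair.

The field `v` is a shear flow, a multiple of `sin (N x_q) e_r`, with `N = ⌈√(p/n)⌉`. The field `w`
has the modes `(j N) e_q ± e_r` with `-2 ≤ j ≤ 2`; the amplitudes have length `1`, except at
`j = ±2`, where the length is `2^{-p}` and compensates the large factor `|k|^p`. As `v` couples only
neighbouring `j`, the form `⟨𝒫(v, w) | w⟩_p` telescopes into differences of `|k|^{2p}` at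
consecutive `j`, weighted by the cosines of the angles between the amplitudes
(`IsLadder.sobolevInner`). The Leray projection disappears because `w` is divergence free. In
dimension `d ≥ 3` all the amplitudes are parallel to a third axis and the cosines are `±1`; in
dimension two the amplitude at `k` is orthogonal to `k`, and the cosines are explicit functions
of `N`. The signs of the amplitudes are such that the contributions of `j` and `-j` add up.

Multiplying by powers of `x = n / p` and using `1 ≤ x N ^ 2` in the numerator and
`√x N ≤ 1 + √x` in the norms turns the ratio into the explicit bound: `Σ_{pn}` and `Υ_{pn}` bound the
rescaled squared norms of `w` of orders `p` and `n` (`KatoBound.ladderNum_le`). In dimension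
`d ≥ 3` the numerator is then the one required; in dimension two it is larger, with equality at
`x = 1`, by the elementary inequalities `outer_modes_le` and `inner_modes_le`.

The asymptotics follow from the second-order expansion of `log (1 + b y + a y ^ 2)` at
`y = √(n / p)`, multiplied by `p = n / y ^ 2` (`tendsto_rpow_div_exp`).
-/

noncomputable section

namespace KatoTorus

/-! ### The exponential modes -/

lemma integral_fourier (n : ℤ) :
    ∫ x : AddCircle (2 * Real.pi), fourier n x = if n = 0 then ((2 * Real.pi : ℝ) : ℂ) else 0 := by
  split_ifs with h
  · subst h
    simp [Measure.real, AddCircle.measure_univ, Real.pi_pos.le]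
  · exact integral_eq_zero_of_add_right_eq_neg (fourier_add_half_inv_index h Real.two_pi_pos)

variable {d : ℕ}

lemma expMode_add (k l : Fin d → ℤ) (x : Torus d) :
    expMode k x * expMode l x
      = (((2 * Real.pi) ^ (-((d : ℝ) / 2)) : ℝ) : ℂ) * expMode (k + l) x := by
  simp only [expMode, Pi.add_apply, fourier_add, Finset.prod_mul_distrib]
  ring

lemma conj_expMode (k : Fin d → ℤ) (x : Torus d) : conj (expMode k x) = expMode (-k) x := by
  simp only [expMode, Pi.neg_apply, fourier_neg, map_mul, map_prod, Complex.conj_ofReal]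

lemma continuous_expMode (k : Fin d → ℤ) : Continuous (expMode (d := d) k) := by
  unfold expMode
  fun_prop

lemma integral_expMode (k : Fin d → ℤ) :
    ∫ x : Torus d, expMode k x
      = if k = 0 then (((2 * Real.pi) ^ ((d : ℝ) / 2) : ℝ) : ℂ) else 0 := by
  unfold expMode
  rw [integral_const_mul, integral_fintype_prod_volume_eq_prod (fun s x => fourier (k s) x)]
  simp only [integral_fourier]
  split_ifs with h
  · subst h
    simp only [Pi.zero_apply, if_true, Finset.prod_const, Finset.card_univ, Fintype.card_fin]
    rw [← Complex.ofReal_pow, ← Complex.ofReal_mul, ← Real.rpow_natCast,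
      ← Real.rpow_add Real.two_pi_pos]
    congr 2
    ring
  · obtain ⟨s, hs⟩ := Function.ne_iff.mp h
    rw [Finset.prod_eq_zero (Finset.mem_univ s) (if_neg hs), mul_zero]

lemma integral_conj_expMode_mul (k l : Fin d → ℤ) :
    ∫ x : Torus d, conj (expMode k x) * expMode l x = if l = k then 1 else 0 := by
  simp_rw [conj_expMode, expMode_add]
  rw [integral_const_mul, integral_expMode]
  simp only [neg_add_eq_zero, eq_comm (a := k)]
  split_ifs
  · rw [← Complex.ofReal_mul, ← Real.rpow_add Real.two_pi_pos, neg_add_cancel, Real.rpow_zero,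
      Complex.ofReal_one]
  · simp

lemma integrable_of_continuous {f : Torus d → ℂ} (hf : Continuous f) : Integrable f :=
  hf.integrable_of_hasCompactSupport (HasCompactSupport.of_compactSpace f)

/-! ### Real trigonometric vector fields -/

variable {ι ι' : Type*} [Fintype ι] [Fintype ι']

/-- The real part of the trigonometric polynomial `∑ i, a i * e_{κ i}`. -/
def trigField (κ : ι → Fin d → ℤ) (a : ι → EuclideanSpace ℂ (Fin d)) : VField d := fun x =>
  WithLp.toLp 2 fun s => (∑ i, a i s * expMode (κ i) x).re

/-- The symmetry of frequencies and amplitudes under an involution `σ` of the index set which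
makes `∑ i, a i * e_{κ i}` real-valued. -/
structure IsHermitianFamily (σ : Equiv.Perm ι) (κ : ι → Fin d → ℤ)
    (a : ι → EuclideanSpace ℂ (Fin d)) : Prop where
  freq : ∀ i, κ (σ i) = -κ i
  amp : ∀ i s, a (σ i) s = conj (a i s)

lemma IsHermitianFamily.ofReal_trigField {σ : Equiv.Perm ι} {κ : ι → Fin d → ℤ}
    {a : ι → EuclideanSpace ℂ (Fin d)} (h : IsHermitianFamily σ κ a) (x : Torus d) (s : Fin d) :
    ((trigField κ a x s : ℝ) : ℂ) = ∑ i, a i s * expMode (κ i) x := by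
  refine Complex.conj_eq_iff_re.mp ?_
  rw [map_sum, ← Equiv.sum_comp σ fun i => a i s * expMode (κ i) x]
  refine Finset.sum_congr rfl fun i _ => ?_
  rw [h.freq, h.amp, map_mul, conj_expMode]

lemma continuous_trigField (κ : ι → Fin d → ℤ) (a : ι → EuclideanSpace ℂ (Fin d)) :
    Continuous (trigField κ a) := by
  have := fun i => continuous_expMode (κ i)
  unfold trigField
  fun_prop

lemma memLp_trigField (κ : ι → Fin d → ℤ) (a : ι → EuclideanSpace ℂ (Fin d)) :
    MemLp (trigField κ a) 2 volume :=
  (continuous_trigField κ a).memLp_of_hasCompactSupport (HasCompactSupport.of_compactSpace _)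

lemma IsHermitianFamily.coeff_trigField {σ : Equiv.Perm ι} {κ : ι → Fin d → ℤ}
    {a : ι → EuclideanSpace ℂ (Fin d)} (h : IsHermitianFamily σ κ a) (k : Fin d → ℤ) :
    coeff (trigField κ a) k = ∑ i, if κ i = k then a i else 0 := by
  ext s
  have hc := fun k => continuous_expMode (d := d) k
  simp only [coeff, h.ofReal_trigField, Finset.mul_sum, WithLp.ofLp_sum, Finset.sum_apply]
  rw [integral_finsetSum _ fun i _ => integrable_of_continuous (by fun_prop)]
  refine Finset.sum_congr rfl fun i _ => ?_
  simp_rw [mul_left_comm _ (a i s)]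
  rw [integral_const_mul, integral_conj_expMode_mul]
  split_ifs <;> simp

/-- On an injective family of frequencies, a Hermitian trigonometric polynomial has its amplitudes
as Fourier coefficients. -/
lemma IsHermitianFamily.coeff_trigField_freq {σ : Equiv.Perm ι} {κ : ι → Fin d → ℤ}
    {a : ι → EuclideanSpace ℂ (Fin d)} (h : IsHermitianFamily σ κ a)
    (hκ : Function.Injective κ) (i : ι) : coeff (trigField κ a) (κ i) = a i := by
  classical
  rw [h.coeff_trigField]
  simp [hκ.eq_iff]

lemma IsHermitianFamily.coeff_trigField_eq_zero {σ : Equiv.Perm ι} {κ : ι → Fin d → ℤ}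
    {a : ι → EuclideanSpace ℂ (Fin d)} (h : IsHermitianFamily σ κ a) {k : Fin d → ℤ}
    (hk : k ∉ Set.range κ) : coeff (trigField κ a) k = 0 := by
  rw [h.coeff_trigField]
  exact Finset.sum_eq_zero fun i _ => if_neg fun hi => hk ⟨i, hi⟩

/-- A series weighted by the coefficients of a trigonometric field is a finite sum over its
frequencies. -/
lemma IsHermitianFamily.hasSum_coeff {E : Type*} [AddCommGroup E] [TopologicalSpace E]
    {σ : Equiv.Perm ι} {κ : ι → Fin d → ℤ}
    {a : ι → EuclideanSpace ℂ (Fin d)} (h : IsHermitianFamily σ κ a) (hκ : Function.Injective κ)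
    (F : (Fin d → ℤ) → EuclideanSpace ℂ (Fin d) → E) (hF : ∀ k, F k 0 = 0) :
    HasSum (fun k => F k (coeff (trigField κ a) k)) (∑ i, F (κ i) (a i)) := by
  have := hκ.hasSum_iff (f := fun k => F k (coeff (trigField κ a) k)) (a := ∑ i, F (κ i) (a i))
    (fun k hk => by rw [h.coeff_trigField_eq_zero hk, hF])
  rw [← this]
  convert hasSum_fintype (fun i => F (κ i) (a i)) using 1
  funext i
  simp [h.coeff_trigField_freq hκ]

lemma IsHermitianFamily.memSobolev {σ : Equiv.Perm ι} {κ : ι → Fin d → ℤ}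
    {a : ι → EuclideanSpace ℂ (Fin d)} (h : IsHermitianFamily σ κ a) (hκ : Function.Injective κ)
    (h0 : ∀ i, κ i ≠ 0) (hdiv : ∀ i, ∑ s, (κ i s : ℂ) * a i s = 0) (m : ℝ) :
    MemSobolev m (trigField κ a) where
  memLp := memLp_trigField κ a
  mean_zero := h.coeff_trigField_eq_zero fun ⟨i, hi⟩ => h0 i hi
  div_free k := by
    by_cases hk : k ∈ Set.range κ
    · obtain ⟨i, rfl⟩ := hk
      rw [h.coeff_trigField_freq hκ, hdiv]
    · simp [h.coeff_trigField_eq_zero hk]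
  summable := (h.hasSum_coeff hκ (fun k c => latNorm k ^ (2 * m) * ‖c‖ ^ 2) (by simp)).summable

lemma IsHermitianFamily.sobolevNorm_trigField {σ : Equiv.Perm ι} {κ : ι → Fin d → ℤ}
    {a : ι → EuclideanSpace ℂ (Fin d)} (h : IsHermitianFamily σ κ a) (hκ : Function.Injective κ)
    (m : ℝ) :
    sobolevNorm m (trigField κ a) = √(∑ i, latNorm (κ i) ^ (2 * m) * ‖a i‖ ^ 2) := by
  rw [sobolevNorm,
    (h.hasSum_coeff hκ (fun k c => latNorm k ^ (2 * m) * ‖c‖ ^ 2) (by simp)).tsum_eq]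

lemma IsHermitianFamily.gradient {ι : Type*} {σ : Equiv.Perm ι} {κ : ι → Fin d → ℤ}
    {a : ι → EuclideanSpace ℂ (Fin d)} (h : IsHermitianFamily σ κ a) (r : Fin d) :
    IsHermitianFamily σ κ fun i => (Complex.I * (κ i r : ℂ)) • a i where
  freq := h.freq
  amp i s := by simp [h.freq, h.amp]

lemma IsHermitianFamily.isGradient {σ : Equiv.Perm ι} {κ : ι → Fin d → ℤ}
    {a : ι → EuclideanSpace ℂ (Fin d)} (h : IsHermitianFamily σ κ a) :
    IsGradient (trigField κ a) fun r => trigField κ fun i => (Complex.I * (κ i r : ℂ)) • a i := by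
  refine fun r => ⟨memLp_trigField _ _, fun k => ?_⟩
  rw [(h.gradient r).coeff_trigField, h.coeff_trigField, Finset.smul_sum]
  refine Finset.sum_congr rfl fun i _ => ?_
  split_ifs with hi
  · rw [hi]
  · rw [smul_zero]

/-- The convolution formula for the coefficients of `v·∂w`. -/
lemma coeff_convective_trigField {σ : Equiv.Perm ι} {κ : ι → Fin d → ℤ}
    {a : ι → EuclideanSpace ℂ (Fin d)} (h : IsHermitianFamily σ κ a)
    {σ' : Equiv.Perm ι'} {κ' : ι' → Fin d → ℤ}
    {b : ι' → EuclideanSpace ℂ (Fin d)} (h' : IsHermitianFamily σ' κ' b) (k : Fin d → ℤ) :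
    coeff (convective (trigField κ a)
        fun r => trigField κ' fun j => (Complex.I * (κ' j r : ℂ)) • b j) k
      = (((2 * Real.pi) ^ (-((d : ℝ) / 2)) : ℝ) : ℂ) • ∑ j, ∑ i,
          if κ i + κ' j = k then (Complex.I * ∑ r, a i r * (κ' j r : ℂ)) • b j else 0 := by
  ext s
  have hc := fun k => continuous_expMode (d := d) k
  have key : ∀ x : Torus d,
      ((convective (trigField κ a)
        (fun r => trigField κ' fun j => (Complex.I * (κ' j r : ℂ)) • b j) x s : ℝ) : ℂ)
      = ∑ j, ∑ i, (((2 * Real.pi) ^ (-((d : ℝ) / 2)) : ℝ) : ℂ) *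
          ((Complex.I * ∑ r, a i r * (κ' j r : ℂ)) * b j s) * expMode (κ i + κ' j) x := by
    intro x
    simp only [convective, WithLp.ofLp_sum, WithLp.ofLp_smul, Finset.sum_apply, Pi.smul_apply,
      smul_eq_mul, Complex.ofReal_sum, Complex.ofReal_mul, h.ofReal_trigField,
      (h'.gradient _).ofReal_trigField]
    simp_rw [Finset.sum_mul_sum, Finset.mul_sum, Finset.sum_mul, Finset.mul_sum, Finset.sum_mul]
    rw [Finset.sum_comm' (t' := Finset.univ) (s' := fun _ => Finset.univ) (by simp)]
    conv_rhs => rw [Finset.sum_comm]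
    refine Finset.sum_congr rfl fun i _ => ?_
    rw [Finset.sum_comm]
    refine Finset.sum_congr rfl fun j _ => Finset.sum_congr rfl fun r _ => ?_
    linear_combination (a i r * (Complex.I * (κ' j r : ℂ)) * b j s) * expMode_add (κ i) (κ' j) x
  have hmul : ∀ (x : Torus d) (C : ι' → ι → ℂ),
      conj (expMode k x) * ∑ j, ∑ i, C j i * expMode (κ i + κ' j) x
        = ∑ j, ∑ i, C j i * (conj (expMode k x) * expMode (κ i + κ' j) x) := by
    intro x C
    simp_rw [Finset.mul_sum, mul_left_comm]
  simp only [coeff, key, hmul]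
  rw [integral_finsetSum _ fun i _ => integrable_of_continuous (by fun_prop)]
  simp only [WithLp.ofLp_smul, WithLp.ofLp_sum, Pi.smul_apply, Finset.sum_apply, smul_eq_mul,
    Finset.mul_sum (a := (((2 * Real.pi) ^ (-((d : ℝ) / 2)) : ℝ) : ℂ))]
  refine Finset.sum_congr rfl fun j _ => ?_
  rw [integral_finsetSum _ fun i _ => integrable_of_continuous (by fun_prop)]
  refine Finset.sum_congr rfl fun i _ => ?_
  rw [integral_const_mul, integral_conj_expMode_mul]
  split_ifs <;> simp

/-- The Leray projection is invisible when tested against a vector orthogonal to `k`. -/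
lemma inner_leray (k : Fin d → ℤ) (c u : EuclideanSpace ℂ (Fin d))
    (hu : ∑ s, (k s : ℂ) * u s = 0) : inner ℂ (leray k c) u = inner ℂ c u := by
  have hu' : u ∈ (Submodule.span ℂ {latVec k})ᗮ := by
    rw [Submodule.mem_orthogonal_singleton_iff_inner_right]
    simpa [latVec, PiLp.inner_apply, mul_comm] using hu
  rw [leray, Submodule.inner_starProjection_left_eq_right,
    Submodule.starProjection_eq_self_iff.mpr hu']

lemma sobolevInner_nsBilinear_trigField {σ : Equiv.Perm ι} {κ : ι → Fin d → ℤ}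
    {a : ι → EuclideanSpace ℂ (Fin d)} (h : IsHermitianFamily σ κ a)
    {σ' : Equiv.Perm ι'} {κ' : ι' → Fin d → ℤ}
    {b : ι' → EuclideanSpace ℂ (Fin d)} (h' : IsHermitianFamily σ' κ' b)
    (hκ' : Function.Injective κ') (hdiv : ∀ i, ∑ s, (κ' i s : ℂ) * b i s = 0) (p : ℝ) :
    sobolevInner p (nsBilinear (trigField κ a)
        fun r => trigField κ' fun j => (Complex.I * (κ' j r : ℂ)) • b j) (coeff (trigField κ' b))
      = (((2 * Real.pi) ^ (-((d : ℝ) / 2)) : ℝ) : ℂ) * ∑ l, ∑ j, ∑ i,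
          if κ i + κ' j = κ' l then ((latNorm (κ' l) ^ (2 * p) : ℝ) : ℂ) *
            (conj (Complex.I * ∑ r, a i r * (κ' j r : ℂ)) * inner ℂ (b j) (b l)) else 0 := by
  unfold sobolevInner nsBilinear
  rw [(h'.hasSum_coeff hκ' (fun k c => ((latNorm k ^ (2 * p) : ℝ) : ℂ) *
    inner ℂ (leray k (coeff (convective (trigField κ a)
      fun r => trigField κ' fun j => (Complex.I * (κ' j r : ℂ)) • b j) k)) c) (by simp)).tsum_eq,
    Finset.mul_sum]
  refine Finset.sum_congr rfl fun l _ => ?_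
  rw [inner_leray _ _ _ (hdiv l), coeff_convective_trigField h h', inner_smul_left,
    Complex.conj_ofReal, mul_left_comm, sum_inner, Finset.mul_sum]
  congr 1
  refine Finset.sum_congr rfl fun j _ => ?_
  rw [sum_inner, Finset.mul_sum]
  refine Finset.sum_congr rfl fun i _ => ?_
  split_ifs
  · rw [inner_smul_left]
  · simp

/-! ### The trial fields -/

/-- The sign `±1` encoded by a Boolean. -/
def boolSign (b : Bool) : ℤ := if b then 1 else -1

@[simp] lemma boolSign_true : boolSign true = 1 := rfl

@[simp] lemma boolSign_false : boolSign false = -1 := rfl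

lemma boolSign_not (b : Bool) : boolSign (!b) = -boolSign b := by cases b <;> rfl

lemma boolSign_injective : Function.Injective boolSign := by decide

/-- The frequencies `±N e_q` of the shear flow `v`. -/
def shearFreq (q : Fin d) (N : ℕ) (b : Bool) : Fin d → ℤ := Pi.single q (boolSign b * N)

/-- The amplitudes `∓i e_r` of the shear flow `v`, which is a multiple of `sin (N x_q) e_r`. -/
def shearAmp (r : Fin d) (b : Bool) : EuclideanSpace ℂ (Fin d) :=
  EuclideanSpace.single r (-(Complex.I * (boolSign b : ℂ)))

/-- The frequencies `(j N) e_q ± e_r`, `-2 ≤ j ≤ 2`, of the transported field `w`; the integer `j`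
is encoded as `j + 2` in `Fin 5`. -/
def ladderFreq (q r : Fin d) (N : ℕ) (i : Fin 5 × Bool) : Fin d → ℤ :=
  Pi.single q (((i.1 : ℕ) - 2 : ℤ) * N) + Pi.single r (boolSign i.2)

/-- The amplitudes of the transported field `w`: the vector `W j` at the frequency
`(j N) e_q + e_r` and, by reality, the same vector at the opposite frequency. -/
def ladderAmp (W : Fin 5 → Fin d → ℝ) (i : Fin 5 × Bool) : EuclideanSpace ℂ (Fin d) :=
  WithLp.toLp 2 fun s => (W (if i.2 then i.1 else i.1.rev) s : ℂ)

lemma isHermitianFamily_shear (q r : Fin d) (N : ℕ) :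
    IsHermitianFamily Equiv.boolNot (shearFreq q N) (shearAmp r) where
  freq b := by simp [shearFreq, boolSign_not, ← Pi.single_neg]
  amp b s := by
    by_cases h : s = r
    · subst h; simp [shearAmp, boolSign_not]
    · simp [shearAmp, h]

lemma coe_rev_sub_two (j : Fin 5) : (((j.rev : Fin 5) : ℕ) - 2 : ℤ) = -((j : ℕ) - 2 : ℤ) := by
  revert j; decide

lemma isHermitianFamily_ladder (q r : Fin d) (N : ℕ) (W : Fin 5 → Fin d → ℝ) :
    IsHermitianFamily (Fin.revPerm.prodCongr Equiv.boolNot) (ladderFreq q r N) (ladderAmp W) where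
  freq i := by
    simp only [ladderFreq, Equiv.prodCongr_apply, Prod.map_fst, Prod.map_snd, Fin.revPerm_apply,
      Equiv.boolNot_apply, boolSign_not, coe_rev_sub_two, neg_mul, Pi.single_neg, neg_add]
  amp i s := by
    rcases i with ⟨j, b⟩
    cases b <;> simp [ladderAmp]

lemma shearFreq_injective (q : Fin d) {N : ℕ} (hN : N ≠ 0) :
    Function.Injective (shearFreq q N) := by
  intro b c h
  have := Pi.single_injective q h
  exact boolSign_injective (mul_right_cancel₀ (by exact_mod_cast hN) this)

lemma shearFreq_add_ladderFreq_iff {q r : Fin d} (hqr : q ≠ r) {N : ℕ} (hN : N ≠ 0) (b : Bool)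
    (i i' : Fin 5 × Bool) : shearFreq q N b + ladderFreq q r N i = ladderFreq q r N i' ↔
      i.2 = i'.2 ∧ ((i'.1 : ℕ) : ℤ) = (i.1 : ℕ) + boolSign b := by
  have hN' : (N : ℤ) ≠ 0 := by exact_mod_cast hN
  constructor
  · intro h
    have h1 := congrFun h q
    have h2 := congrFun h r
    simp only [shearFreq, ladderFreq, Pi.add_apply, Pi.single_eq_same,
      Pi.single_eq_of_ne hqr, Pi.single_eq_of_ne hqr.symm, add_zero, zero_add] at h1 h2
    refine ⟨boolSign_injective h2, mul_right_cancel₀ hN' ?_⟩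
    linear_combination -h1
  · rintro ⟨h1, h2⟩
    rw [shearFreq, ladderFreq, ladderFreq, h1, h2, ← add_assoc, ← Pi.single_add]
    congr 2
    ring

lemma ladderFreq_injective {q r : Fin d} (hqr : q ≠ r) {N : ℕ} (hN : N ≠ 0) :
    Function.Injective (ladderFreq q r N) := by
  intro i j h
  have h' : shearFreq q N true + ladderFreq q r N i = shearFreq q N true + ladderFreq q r N j := by
    rw [h]
  have h1 := congrFun h q
  have h2 := congrFun h r
  simp only [ladderFreq, Pi.add_apply, Pi.single_eq_same,
    Pi.single_eq_of_ne hqr, Pi.single_eq_of_ne hqr.symm, add_zero, zero_add] at h1 h2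
  have h3 := mul_right_cancel₀ (by exact_mod_cast hN) h1
  exact Prod.ext (Fin.ext (by omega)) (boolSign_injective h2)

lemma latNorm_shearFreq (q : Fin d) (N : ℕ) (b : Bool) : latNorm (shearFreq q N b) = N := by
  have : ∑ s, (shearFreq q N b s : ℝ) ^ 2 = (N : ℝ) ^ 2 := by
    rw [Finset.sum_eq_single q (fun s _ hs => by simp [shearFreq, hs]) (by simp)]
    cases b <;> simp [shearFreq]
  rw [latNorm, this, Real.sqrt_sq (Nat.cast_nonneg N)]

lemma latNorm_ladderFreq_rpow {q r : Fin d} (hqr : q ≠ r) (N : ℕ) (i : Fin 5 × Bool) (p : ℝ) :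
    latNorm (ladderFreq q r N i) ^ (2 * p)
      = ((((i.1 : ℕ) : ℝ) - 2) ^ 2 * (N : ℝ) ^ 2 + 1) ^ p := by
  have : ∑ s, (ladderFreq q r N i s : ℝ) ^ 2 = (((i.1 : ℕ) : ℝ) - 2) ^ 2 * (N : ℝ) ^ 2 + 1 := by
    rw [← Finset.sum_subset (Finset.subset_univ {q, r}) fun s _ hs => ?_, Finset.sum_pair hqr]
    · rcases i with ⟨j, b⟩
      cases b <;> simp [ladderFreq, hqr, hqr.symm, mul_pow]
    · simp only [Finset.mem_insert, Finset.mem_singleton, not_or] at hs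
      simp [ladderFreq, hs.1, hs.2]
  rw [latNorm, this, Real.rpow_mul (Real.sqrt_nonneg _), Real.rpow_two, Real.sq_sqrt (by positivity)]

lemma sum_freq_mul_eq_zero_shear {q r : Fin d} (hqr : q ≠ r) (N : ℕ) (b : Bool) :
    ∑ s, (shearFreq q N b s : ℂ) * shearAmp r b s = 0 := by
  refine Finset.sum_eq_zero fun s _ => ?_
  by_cases h : s = q
  · subst h; simp [shearAmp, hqr]
  · simp [shearFreq, h]

lemma sum_freq_mul_eq_zero_ladder {q r : Fin d} (hqr : q ≠ r) (N : ℕ) {W : Fin 5 → Fin d → ℝ}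
    (hW : ∀ j : Fin 5, (((j : ℕ) : ℝ) - 2) * N * W j q + W j r = 0) (i : Fin 5 × Bool) :
    ∑ s, (ladderFreq q r N i s : ℂ) * ladderAmp W i s = 0 := by
  rw [← Finset.sum_subset (Finset.subset_univ {q, r}) fun s _ hs => ?_, Finset.sum_pair hqr]
  · rcases i with ⟨j, b⟩
    cases b
    · have h1 := hW j.rev
      have h2 : (((j.rev : Fin 5) : ℕ) - 2 : ℝ) = -((j : ℕ) - 2 : ℝ) := by
        exact_mod_cast coe_rev_sub_two j
      rw [h2] at h1
      have h3 : (((-((j : ℕ) - 2 : ℝ)) * N * W j.rev q + W j.rev r : ℝ) : ℂ) = 0 := by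
        rw [h1, Complex.ofReal_zero]
      push_cast at h3
      simp [ladderFreq, ladderAmp, hqr, hqr.symm]
      linear_combination -h3
    · have h3 : (((((j : ℕ) : ℝ) - 2) * N * W j q + W j r : ℝ) : ℂ) = 0 := by
        rw [hW j, Complex.ofReal_zero]
      push_cast at h3
      simp [ladderFreq, ladderAmp, hqr, hqr.symm]
      linear_combination h3
  · simp only [Finset.mem_insert, Finset.mem_singleton, not_or] at hs
    simp [ladderFreq, hs.1, hs.2]

lemma inner_ladderAmp (W : Fin 5 → Fin d → ℝ) (i j : Fin 5 × Bool) :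
    inner ℂ (ladderAmp W i) (ladderAmp W j) =
      ((W (if i.2 then i.1 else i.1.rev) ⬝ᵥ W (if j.2 then j.1 else j.1.rev) : ℝ) : ℂ) := by
  simp [PiLp.inner_apply, ladderAmp, dotProduct, mul_comm]

lemma norm_ladderAmp_sq (W : Fin 5 → Fin d → ℝ) (i : Fin 5 × Bool) :
    ‖ladderAmp W i‖ ^ 2 =
      W (if i.2 then i.1 else i.1.rev) ⬝ᵥ W (if i.2 then i.1 else i.1.rev) := by
  have := inner_self_eq_norm_sq_to_K (𝕜 := ℂ) (ladderAmp W i)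
  rw [inner_ladderAmp] at this
  exact Complex.ofReal_injective (by simpa using this.symm)

lemma sobolevNorm_shear (q r : Fin d) {N : ℕ} (hN : N ≠ 0) (m : ℝ) :
    sobolevNorm m (trigField (shearFreq q N) (shearAmp r)) = √2 * (N : ℝ) ^ m := by
  rw [(isHermitianFamily_shear q r N).sobolevNorm_trigField (shearFreq_injective q hN)]
  have : ∀ b, ‖shearAmp r b‖ = 1 := by
    intro b
    cases b <;> simp [shearAmp]
  simp only [latNorm_shearFreq, this, Fintype.sum_bool, one_pow, mul_one]
  rw [← two_mul, Real.sqrt_mul zero_le_two, mul_comm 2 m, Real.rpow_mul (Nat.cast_nonneg N),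
    Real.rpow_two, Real.sqrt_sq (by positivity)]

/-- A quarter of the squared Sobolev norm of order `m` of the transported field, when the outer
modes have amplitude `β`. -/
def ladderSum (β : ℝ) (N : ℕ) (m : ℝ) : ℝ :=
  ((N : ℝ) ^ 2 + 1) ^ m + β ^ 2 * (4 * (N : ℝ) ^ 2 + 1) ^ m + 1 / 2

/-- The requirements on the amplitudes `W j` of the transported field: divergence-freeness, unit
length except for the outer modes, of length `β`, and angles between neighbours with cosines `±γ`,
`±δ`, whose signs make the contributions of `j ≥ 0` and `j ≤ 0` to the trilinear form add up. -/
structure IsLadder (q r : Fin d) (N : ℕ) (β γ δ : ℝ) (W : Fin 5 → Fin d → ℝ) : Prop where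
  div_free : ∀ j : Fin 5, (((j : ℕ) : ℝ) - 2) * N * W j q + W j r = 0
  outer : ∀ j, j = 0 ∨ j = 4 → W j ⬝ᵥ W j = β ^ 2
  inner : ∀ j, j = 1 ∨ j = 2 ∨ j = 3 → W j ⬝ᵥ W j = 1
  dot01 : W 0 ⬝ᵥ W 1 = -(β * δ)
  dot12 : W 1 ⬝ᵥ W 2 = -γ
  dot23 : W 2 ⬝ᵥ W 3 = γ
  dot34 : W 3 ⬝ᵥ W 4 = β * δ

lemma IsLadder.sobolevNorm {q r : Fin d} (hqr : q ≠ r) {N : ℕ} (hN : N ≠ 0) {β γ δ : ℝ}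
    {W : Fin 5 → Fin d → ℝ} (hW : IsLadder q r N β γ δ W) (m : ℝ) :
    sobolevNorm m (trigField (ladderFreq q r N) (ladderAmp W)) = 2 * √(ladderSum β N m) := by
  rw [(isHermitianFamily_ladder q r N W).sobolevNorm_trigField (ladderFreq_injective hqr hN)]
  have h0 := hW.outer 0 (by simp)
  have h4 := hW.outer 4 (by simp)
  have h1 := hW.inner 1 (by simp)
  have h2 := hW.inner 2 (by simp)
  have h3 := hW.inner 3 (by simp)
  have e0 : Fin.rev (0 : Fin 5) = 4 := rfl
  have e1 : Fin.rev (1 : Fin 5) = 3 := rfl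
  have e2 : Fin.rev (2 : Fin 5) = 2 := rfl
  have e3 : Fin.rev (3 : Fin 5) = 1 := rfl
  have e4 : Fin.rev (4 : Fin 5) = 0 := rfl
  have : ∑ i, latNorm (ladderFreq q r N i) ^ (2 * m) * ‖ladderAmp W i‖ ^ 2
      = 2 ^ 2 * ladderSum β N m := by
    simp only [latNorm_ladderFreq_rpow hqr, norm_ladderAmp_sq, Fintype.sum_prod_type,
      Fin.sum_univ_five, Fintype.sum_bool, if_true, Bool.false_eq_true, if_false, e0, e1, e2, e3,
      e4, h0, h1, h2, h3, h4, ladderSum]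
    norm_num
    ring
  rw [this, Real.sqrt_mul (by norm_num), Real.sqrt_sq zero_le_two]

/-- The shear flow couples only neighbouring modes, so that the trilinear form telescopes. -/
lemma IsLadder.sobolevInner {q r : Fin d} (hqr : q ≠ r) {N : ℕ} (hN : N ≠ 0) {β γ δ : ℝ}
    {W : Fin 5 → Fin d → ℝ} (hW : IsLadder q r N β γ δ W) (p : ℝ) :
    sobolevInner p (nsBilinear (trigField (shearFreq q N) (shearAmp r))
        fun s => trigField (ladderFreq q r N) fun j =>
          (Complex.I * (ladderFreq q r N j s : ℂ)) • ladderAmp W j)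
        (coeff (trigField (ladderFreq q r N) (ladderAmp W)))
      = (((2 * Real.pi) ^ (-((d : ℝ) / 2)) * (4 * (γ * (((N : ℝ) ^ 2 + 1) ^ p - 1) +
          β * δ * ((4 * (N : ℝ) ^ 2 + 1) ^ p - ((N : ℝ) ^ 2 + 1) ^ p))) : ℝ) : ℂ) := by
  rw [sobolevInner_nsBilinear_trigField (isHermitianFamily_shear q r N)
    (isHermitianFamily_ladder q r N W) (ladderFreq_injective hqr hN)
    (sum_freq_mul_eq_zero_ladder hqr N hW.div_free), Complex.ofReal_mul]
  congr 1
  have hI : ∀ (b : Bool) (j : Fin 5 × Bool),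
      conj (Complex.I * ∑ s, shearAmp r b s * (ladderFreq q r N j s : ℂ))
        = ((boolSign b * boolSign j.2 : ℝ) : ℂ) := by
    intro b j
    rw [Finset.sum_eq_single r (fun s _ hs => by simp [shearAmp, hs]) (by simp)]
    simp only [shearAmp, ladderFreq, Pi.add_apply, Pi.single_eq_same, Pi.single_eq_of_ne hqr.symm,
      zero_add, PiLp.single_apply, if_true, map_mul, map_neg, Complex.conj_I]
    have := Complex.I_mul_I
    simp
    linear_combination (-(boolSign b : ℂ) * boolSign j.2) * this
  have h01 := hW.dot01
  have h12 := hW.dot12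
  have h23 := hW.dot23
  have h34 := hW.dot34
  have h10 := (dotProduct_comm _ _).trans hW.dot01
  have h21 := (dotProduct_comm _ _).trans hW.dot12
  have h32 := (dotProduct_comm _ _).trans hW.dot23
  have h43 := (dotProduct_comm _ _).trans hW.dot34
  have e0 : Fin.rev (0 : Fin 5) = 4 := rfl
  have e1 : Fin.rev (1 : Fin 5) = 3 := rfl
  have e2 : Fin.rev (2 : Fin 5) = 2 := rfl
  have e3 : Fin.rev (3 : Fin 5) = 1 := rfl
  have e4 : Fin.rev (4 : Fin 5) = 0 := rfl
  simp only [shearFreq_add_ladderFreq_iff hqr hN, hI, latNorm_ladderFreq_rpow hqr,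
    inner_ladderAmp, ← Complex.ofReal_mul]
  simp only [Fintype.sum_prod_type, Fin.sum_univ_five, Fintype.sum_bool, boolSign_true,
    boolSign_false]
  norm_num [e0, e1, e2, e3, e4, h01, h12, h23, h34, h10, h21, h32, h43]
  ring

/-- The lower bound for admissible constants furnished by a shear flow and a ladder field. -/
lemma KatoBound.ladder_le {p n C : ℝ} (hC : KatoBound d p n C) {q r : Fin d} (hqr : q ≠ r)
    {N : ℕ} (hN : N ≠ 0) {β γ δ : ℝ} {W : Fin 5 → Fin d → ℝ} (hW : IsLadder q r N β γ δ W) :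
    √2 * (2 * Real.pi) ^ (-((d : ℝ) / 2)) * (γ * (((N : ℝ) ^ 2 + 1) ^ p - 1) +
          β * δ * ((4 * (N : ℝ) ^ 2 + 1) ^ p - ((N : ℝ) ^ 2 + 1) ^ p)) ≤
      C * (((N : ℝ) ^ p * √(ladderSum β N n) + (N : ℝ) ^ n * √(ladderSum β N p))
        * √(ladderSum β N p)) := by
  have h := isHermitianFamily_shear q r N
  have h' := isHermitianFamily_ladder q r N W
  have hfreq : ∀ b, shearFreq q N b ≠ 0 := by
    intro b hb
    have := latNorm_shearFreq q N b
    rw [hb] at this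
    simp [latNorm] at this
    exact hN (by exact_mod_cast this.symm)
  have hfreq' : ∀ i, ladderFreq q r N i ≠ 0 := by
    intro i hi
    have := congrFun hi r
    simp only [ladderFreq, Pi.add_apply, Pi.single_eq_of_ne hqr.symm, Pi.single_eq_same, zero_add,
      Pi.zero_apply] at this
    rcases i with ⟨j, b⟩
    cases b <;> simp at this
  have key := hC _ _ _
    (h.memSobolev (shearFreq_injective q hN) hfreq (sum_freq_mul_eq_zero_shear hqr N) p)
    (h'.memSobolev (ladderFreq_injective hqr hN) hfreq'
      (sum_freq_mul_eq_zero_ladder hqr N hW.div_free) (p + 1)) h'.isGradient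
  rw [hW.sobolevInner hqr hN, Complex.norm_real, hW.sobolevNorm hqr hN, hW.sobolevNorm hqr hN,
    sobolevNorm_shear q r hN, sobolevNorm_shear q r hN] at key
  have key' := (Real.le_norm_self _).trans key
  have h2 : √2 * √2 = 2 := Real.mul_self_sqrt zero_le_two
  have := mul_le_mul_of_nonneg_left key' (show 0 ≤ √2 / 4 by positivity)
  calc _ = _ := ?_
    _ ≤ _ := this
    _ = _ := ?_
  · ring
  · linear_combination (1 / 2 * C * ((N : ℝ) ^ p * √(ladderSum β N n)
      + (N : ℝ) ^ n * √(ladderSum β N p)) * √(ladderSum β N p)) * h2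

/-! ### Estimates for the trial fields -/

/-- The numerator of the bound given by a ladder field with outer amplitude `2^{-p}`, rescaled:
`x` stands for `n / p`, `s` for `x N^2`, and `γ`, `δ` are the cosines of the angles between
neighbouring amplitudes. -/
def ladderNum (p x s γ δ : ℝ) : ℝ :=
  γ * ((s + x) ^ p - x ^ p) + (2 : ℝ) ^ (-p) * δ * ((4 * s + x) ^ p - (s + x) ^ p)

lemma rpow_mul_ladderSum_le_sigmaFn {p n : ℝ} {N : ℕ} (hn : 0 < n) (hp : 0 < p)
    (hN : √(n / p) * N ≤ 1 + √(n / p)) :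
    (n / p) ^ p * ladderSum (2 ^ (-p)) N p ≤ sigmaFn p n := by
  have hx : 0 < n / p := by positivity
  have hs : √(n / p) * √(n / p) = n / p := Real.mul_self_sqrt hx.le
  have hs0 : 0 ≤ √(n / p) := Real.sqrt_nonneg _
  have hsN : n / p * (N : ℝ) ^ 2 ≤ 1 + 2 * √(n / p) + n / p := by
    have := mul_self_le_mul_self (by positivity) hN
    nlinarith
  have h4 : ((2 : ℝ) ^ (-p)) ^ 2 = (1 / 4) ^ p := by
    rw [← Real.rpow_natCast, ← Real.rpow_mul zero_le_two, Real.rpow_def_of_pos two_pos,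
      Real.rpow_def_of_pos (by norm_num), Real.log_div one_ne_zero four_ne_zero,
      show (4 : ℝ) = 2 ^ 2 by norm_num, Real.log_pow]
    congr 1
    push_cast
    simp
    ring
  have e1 : 5 * n / (4 * p) = 5 / 4 * (n / p) := by field_simp
  have e2 : 2 * n / p = 2 * (n / p) := by field_simp
  rw [sigmaFn, ladderSum, h4, mul_add, mul_add, ← Real.mul_rpow hx.le (by positivity),
    ← Real.mul_rpow (by norm_num) (by positivity), ← Real.mul_rpow hx.le (by positivity), e1, e2]
  have a1 : (n / p * ((N : ℝ) ^ 2 + 1)) ^ p ≤ (1 + 2 * √(n / p) + 2 * (n / p)) ^ p :=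
    Real.rpow_le_rpow (by positivity) (by linarith) hp.le
  have a2 : (n / p * (1 / 4 * (4 * (N : ℝ) ^ 2 + 1))) ^ p
      ≤ (1 + 2 * √(n / p) + 5 / 4 * (n / p)) ^ p :=
    Real.rpow_le_rpow (by positivity) (by linarith) hp.le
  linarith

lemma rpow_mul_ladderSum_le_upsilonFn {p n : ℝ} {N : ℕ} (hn : 0 < n) (hp : 0 < p)
    (hN : √(n / p) * N ≤ 1 + √(n / p)) :
    (n / p) ^ n * ladderSum (2 ^ (-p)) N n ≤ upsilonFn p n := by
  have hx : 0 < n / p := by positivity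
  have hs : √(n / p) * √(n / p) = n / p := Real.mul_self_sqrt hx.le
  have hs0 : 0 ≤ √(n / p) := Real.sqrt_nonneg _
  have hsN : n / p * (N : ℝ) ^ 2 ≤ 1 + 2 * √(n / p) + n / p := by
    have := mul_self_le_mul_self (by positivity) hN
    nlinarith
  have h4 : ((2 : ℝ) ^ (-p)) ^ 2 * (4 * (N : ℝ) ^ 2 + 1) ^ n
      = 1 / 2 ^ (2 * p - 2 * n) * ((N : ℝ) ^ 2 + 1 / 4) ^ n := by
    have : 4 * (N : ℝ) ^ 2 + 1 = 2 ^ (2 : ℝ) * ((N : ℝ) ^ 2 + 1 / 4) := by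
      rw [Real.rpow_two]; ring
    rw [this, Real.mul_rpow (by positivity) (by positivity), ← Real.rpow_mul zero_le_two,
      ← mul_assoc, ← Real.rpow_natCast, ← Real.rpow_mul zero_le_two, ← Real.rpow_add two_pos,
      one_div (2 ^ _), ← Real.rpow_neg zero_le_two]
    congr 2
    push_cast
    ring
  have e1 : 5 * n / (4 * p) = 5 / 4 * (n / p) := by field_simp
  have e2 : 2 * n / p = 2 * (n / p) := by field_simp
  rw [upsilonFn, ladderSum, h4, mul_add, mul_add, mul_left_comm,
    ← Real.mul_rpow hx.le (by positivity), ← Real.mul_rpow hx.le (by positivity), e1, e2]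
  have a1 : (n / p * ((N : ℝ) ^ 2 + 1)) ^ n ≤ (1 + 2 * √(n / p) + 2 * (n / p)) ^ n :=
    Real.rpow_le_rpow (by positivity) (by linarith) hn.le
  have a2 : (n / p * ((N : ℝ) ^ 2 + 1 / 4)) ^ n ≤ (1 + 2 * √(n / p) + 5 / 4 * (n / p)) ^ n :=
    Real.rpow_le_rpow (by positivity) (by linarith) hn.le
  have a3 := mul_le_mul_of_nonneg_left a2
    (show (0 : ℝ) ≤ 1 / 2 ^ (2 * p - 2 * n) by positivity)
  linarith

lemma sigmaFn_pos {p n : ℝ} (hn : 0 < n) (hp : 0 < p) : 0 < sigmaFn p n := by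
  unfold sigmaFn; positivity

lemma upsilonFn_pos {p n : ℝ} (hn : 0 < n) (hp : 0 < p) : 0 < upsilonFn p n := by
  unfold upsilonFn; positivity

lemma denomFn_pos {p n : ℝ} (hn : 0 < n) (hp : 0 < p) : 0 < denomFn p n := by
  have := sigmaFn_pos hn hp
  have := upsilonFn_pos hn hp
  unfold denomFn; positivity

/-- The rescaled product of the norms of the trial fields is at most `D_{pn}`. -/
lemma ladder_denominator_le_denomFn {p n : ℝ} {N : ℕ} (hn : 0 < n) (hp : 0 < p)
    (hN : √(n / p) * N ≤ 1 + √(n / p)) :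
    (n / p) ^ (n / 2) * (n / p) ^ p * (((N : ℝ) ^ p * √(ladderSum (2 ^ (-p)) N n)
      + (N : ℝ) ^ n * √(ladderSum (2 ^ (-p)) N p)) * √(ladderSum (2 ^ (-p)) N p))
      ≤ denomFn p n := by
  have hx : 0 < n / p := by positivity
  have hhalf : ∀ m : ℝ, √((n / p) ^ m) = (n / p) ^ (m / 2) := by
    intro m
    rw [Real.sqrt_eq_rpow, ← Real.rpow_mul hx.le]
    ring_nf
  have hpow : ∀ m : ℝ, 0 < m → (n / p) ^ (m / 2) * (N : ℝ) ^ m ≤ (1 + √(n / p)) ^ m := by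
    intro m hm
    have : (n / p) ^ (m / 2) = √(n / p) ^ m := by
      rw [Real.sqrt_eq_rpow, ← Real.rpow_mul hx.le]
      ring_nf
    rw [this, ← Real.mul_rpow (Real.sqrt_nonneg _) (Nat.cast_nonneg _)]
    exact Real.rpow_le_rpow (by positivity) hN hm.le
  have hS : (n / p) ^ (p / 2) * √(ladderSum (2 ^ (-p)) N p) ≤ √(sigmaFn p n) := by
    rw [← hhalf, ← Real.sqrt_mul (by positivity)]
    exact Real.sqrt_le_sqrt (rpow_mul_ladderSum_le_sigmaFn hn hp hN)
  have hU : (n / p) ^ (n / 2) * √(ladderSum (2 ^ (-p)) N n) ≤ √(upsilonFn p n) := by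
    rw [← hhalf, ← Real.sqrt_mul (by positivity)]
    exact Real.sqrt_le_sqrt (rpow_mul_ladderSum_le_upsilonFn hn hp hN)
  have hpp : (n / p) ^ p = (n / p) ^ (p / 2) * (n / p) ^ (p / 2) := by
    rw [← Real.rpow_add hx, add_halves]
  calc _ = (((n / p) ^ (p / 2) * (N : ℝ) ^ p)
          * ((n / p) ^ (n / 2) * √(ladderSum (2 ^ (-p)) N n))
        + ((n / p) ^ (n / 2) * (N : ℝ) ^ n) * ((n / p) ^ (p / 2) * √(ladderSum (2 ^ (-p)) N p)))
        * ((n / p) ^ (p / 2) * √(ladderSum (2 ^ (-p)) N p)) := by rw [hpp]; ring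
    _ ≤ _ := by
      unfold denomFn
      have := hpow p hp
      have := hpow n hn
      gcongr

/-- The wave number `N` of the trial fields: the least integer with `n / p * N ^ 2 ≥ 1`, so that
also `√(n / p) * N ≤ 1 + √(n / p)`. -/
def waveNumber (p n : ℝ) : ℕ := ⌈√(p / n)⌉₊

lemma waveNumber_ne_zero {p n : ℝ} (hn : 0 < n) (hp : 0 < p) : waveNumber p n ≠ 0 :=
  (Nat.ceil_pos.mpr (by positivity)).ne'

lemma sqrt_mul_waveNumber_le {p n : ℝ} (hn : 0 < n) (hp : 0 < p) :
    √(n / p) * waveNumber p n ≤ 1 + √(n / p) := by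
  have h := (Nat.ceil_lt_add_one (Real.sqrt_nonneg (p / n))).le
  have h1 : √(n / p) * √(p / n) = 1 := by
    rw [← Real.sqrt_mul (by positivity), show n / p * (p / n) = 1 by field_simp, Real.sqrt_one]
  have h2 := mul_le_mul_of_nonneg_left h (Real.sqrt_nonneg (n / p))
  unfold waveNumber
  linarith

lemma one_le_mul_waveNumber_sq {p n : ℝ} (hn : 0 < n) (hp : 0 < p) :
    1 ≤ n / p * (waveNumber p n : ℝ) ^ 2 := by
  have h := Nat.le_ceil √(p / n)
  have h1 : p / n ≤ (waveNumber p n : ℝ) ^ 2 := (Real.sqrt_le_left (Nat.cast_nonneg _)).mp h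
  calc (1 : ℝ) = n / p * (p / n) := by field_simp
    _ ≤ _ := by gcongr

/-- Every admissible constant dominates the bound given by a ladder field of wave number
`N = ⌈√(p/n)⌉` and outer amplitude `2^{-p}`. -/
lemma KatoBound.ladderNum_le {d : ℕ} {p n C : ℝ} (hC : KatoBound d p n C) (hn : 0 < n)
    (hp : 0 < p) {q r : Fin d} (hqr : q ≠ r) {γ δ : ℝ} {W : Fin 5 → Fin d → ℝ}
    (hW : IsLadder q r (waveNumber p n) (2 ^ (-p)) γ δ W)
    (h0 : 0 ≤ ladderNum p (n / p) (n / p * (waveNumber p n : ℝ) ^ 2) γ δ) :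
    √2 * (2 * Real.pi) ^ (-((d : ℝ) / 2)) * (n / p) ^ (n / 2)
      * ladderNum p (n / p) (n / p * (waveNumber p n : ℝ) ^ 2) γ δ / denomFn p n ≤ C := by
  have key := hC.ladder_le hqr (waveNumber_ne_zero hn hp) hW
  have hden := ladder_denominator_le_denomFn hn hp (sqrt_mul_waveNumber_le hn hp)
  have hD := denomFn_pos hn hp
  have hx : 0 < n / p := by positivity
  set N := waveNumber p n
  have hN0 : (0 : ℝ) < N := by exact_mod_cast Nat.pos_of_ne_zero (waveNumber_ne_zero hn hp)
  set R := (((N : ℝ) ^ p * √(ladderSum (2 ^ (-p)) N n) + (N : ℝ) ^ n * √(ladderSum (2 ^ (-p)) N p))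
        * √(ladderSum (2 ^ (-p)) N p)) with hR
  have hR0 : 0 < R := by
    have : ∀ m, 0 < ladderSum (2 ^ (-p)) N m := fun m => by unfold ladderSum; positivity
    have hp' := this p
    have hn' := this n
    positivity
  set L := γ * (((N : ℝ) ^ 2 + 1) ^ p - 1) +
          2 ^ (-p) * δ * ((4 * (N : ℝ) ^ 2 + 1) ^ p - ((N : ℝ) ^ 2 + 1) ^ p)
  have hL : ladderNum p (n / p) (n / p * (N : ℝ) ^ 2) γ δ = (n / p) ^ p * L := by
    have e1 : n / p * (N : ℝ) ^ 2 + n / p = n / p * ((N : ℝ) ^ 2 + 1) := by ring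
    have e2 : 4 * (n / p * (N : ℝ) ^ 2) + n / p = n / p * (4 * (N : ℝ) ^ 2 + 1) := by ring
    rw [ladderNum, e1, e2, Real.mul_rpow hx.le (by positivity),
      Real.mul_rpow hx.le (by positivity)]
    ring
  rw [hL] at h0 ⊢
  have hL0 : 0 ≤ L := nonneg_of_mul_nonneg_right h0 (by positivity)
  have hC0 : 0 ≤ C := by
    refine nonneg_of_mul_nonneg_left ((?_ : (0 : ℝ) ≤ _).trans key) hR0
    positivity
  rw [div_le_iff₀ hD]
  calc _ = (n / p) ^ (n / 2) * (n / p) ^ p * (√2 * (2 * Real.pi) ^ (-((d : ℝ) / 2)) * L) := by ring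
    _ ≤ (n / p) ^ (n / 2) * (n / p) ^ p * (C * R) := by gcongr
    _ = C * ((n / p) ^ (n / 2) * (n / p) ^ p * R) := by ring
    _ ≤ C * denomFn p n := by gcongr

/-- Monotonicity in `s` of `(4 s + x) ^ p - (s + x) ^ p`, compared with the value at `s = 1`. -/
lemma rpow_sub_rpow_mono {p x s : ℝ} (hp : 0 ≤ p) (hx : 0 < x) (hs : 1 ≤ s) :
    (4 + x) ^ p - (1 + x) ^ p ≤ (4 * s + x) ^ p - (s + x) ^ p := by
  -- `(4 s + x) / (4 + x) ≥ (s + x) / (1 + x)`, and both quotients are at least `1`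
  have h1 : (s + x) / (1 + x) ≤ (4 * s + x) / (4 + x) := by
    rw [div_le_div_iff₀ (by positivity) (by positivity)]
    nlinarith
  have h2 : (1 : ℝ) ≤ (s + x) / (1 + x) := by
    rw [le_div_iff₀ (by positivity)]
    linarith
  have e1 : (4 * s + x) ^ p = (4 + x) ^ p * ((4 * s + x) / (4 + x)) ^ p := by
    rw [← Real.mul_rpow (by positivity) (by positivity)]
    congr 1
    field_simp
  have e2 : (s + x) ^ p = (1 + x) ^ p * ((s + x) / (1 + x)) ^ p := by
    rw [← Real.mul_rpow (by positivity) (by positivity)]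
    congr 1
    field_simp
  rw [e1, e2]
  have h3 := Real.rpow_le_rpow (by positivity) h1 hp
  have h4 := Real.one_le_rpow h2 hp
  have h5 : (1 + x) ^ p ≤ (4 + x) ^ p := Real.rpow_le_rpow (by positivity) (by linarith) hp
  have h6 : (0 : ℝ) < (1 + x) ^ p := by positivity
  nlinarith [mul_le_mul h5 (sub_le_sub_right h3 1) (by linarith) (by linarith)]

lemma two_rpow_neg_mul_four_add_rpow {p x : ℝ} (hx : 0 < x) :
    (2 : ℝ) ^ (-p) * (4 + x) ^ p = 2 ^ p * (1 + x / 4) ^ p := by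
  have : 4 + x = 2 * (2 * (1 + x / 4)) := by ring
  rw [this, Real.mul_rpow zero_le_two (by positivity), Real.mul_rpow zero_le_two (by positivity),
    ← mul_assoc, ← Real.rpow_add two_pos, neg_add_cancel, Real.rpow_zero, one_mul]

/-! ### Dimension at least three -/

/-- In dimension `d ≥ 3` all amplitudes may point along a common direction `e_t`. -/
lemma isLadder_const {d : ℕ} {q r t : Fin d} (hq : t ≠ q) (hr : t ≠ r) (N : ℕ) (β : ℝ) :
    IsLadder q r N β 1 1 fun j => Pi.single t (![β, -1, 1, 1, β] j) where
  div_free j := by simp [hq.symm, hr.symm]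
  outer j hj := by rcases hj with rfl | rfl <;> simp [sq]
  inner j hj := by rcases hj with rfl | rfl | rfl <;> simp
  dot01 := by simp
  dot12 := by simp
  dot23 := by simp
  dot34 := by simp

lemma lowerG_le_of_katoBound {d : ℕ} (hd : 3 ≤ d) {p n C : ℝ} (hn : 0 < n) (hp : 0 < p)
    (hC : KatoBound d p n C) : lowerG d p n ≤ C := by
  obtain ⟨q, r, t, hqr, hq, hr⟩ : ∃ q r t : Fin d, q ≠ r ∧ t ≠ q ∧ t ≠ r :=
    ⟨⟨0, by omega⟩, ⟨1, by omega⟩, ⟨2, by omega⟩, by simp, by simp, by simp⟩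
  have hx : 0 < n / p := by positivity
  set x := n / p with hxdef
  have hs := one_le_mul_waveNumber_sq hn hp
  rw [← hxdef] at hs
  set s := x * (waveNumber p n : ℝ) ^ 2 with hsdef
  have hx4 : n / (4 * p) = x / 4 := by rw [hxdef]; field_simp
  have hmono := rpow_sub_rpow_mono hp.le hx hs
  have hmono' : (1 + x) ^ p ≤ (s + x) ^ p := Real.rpow_le_rpow (by positivity) (by linarith) hp.le
  have h2 : (0 : ℝ) < 2 ^ (-p) := by positivity
  have hbound : (1 + n / (4 * p)) ^ p * 2 ^ p + (1 - 1 / 2 ^ p) * (1 + x) ^ p - x ^ p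
      ≤ ladderNum p x s 1 1 := by
    have h3 := mul_le_mul_of_nonneg_left hmono h2.le
    rw [mul_sub, two_rpow_neg_mul_four_add_rpow hx] at h3
    rw [ladderNum, hx4, one_div, ← Real.rpow_neg zero_le_two]
    linarith
  have h0 : 0 ≤ ladderNum p x s 1 1 := by
    have h5 : x ^ p ≤ (s + x) ^ p := Real.rpow_le_rpow hx.le (by linarith) hp.le
    have h6 : (s + x) ^ p ≤ (4 * s + x) ^ p :=
      Real.rpow_le_rpow (by positivity) (by linarith) hp.le
    have := mul_nonneg h2.le (sub_nonneg.mpr h6)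
    rw [ladderNum]
    linarith
  have hD := denomFn_pos hn hp
  refine le_trans ?_ (hC.ladderNum_le hn hp hqr (isLadder_const hq hr _ _) h0)
  rw [lowerG, ← hxdef, ← hsdef, Real.rpow_neg Real.two_pi_pos.le, mul_div_assoc _ _ (denomFn p n),
    ← div_eq_mul_inv]
  gcongr

/-! ### Dimension two -/

lemma vec_two (a b c e f : ℝ) : ![a, b, c, e, f] 2 = c := rfl

lemma vec_three (a b c e f : ℝ) : ![a, b, c, e, f] 3 = e := rfl

lemma vec_four (a b c e f : ℝ) : ![a, b, c, e, f] 4 = f := rfl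

/-- In dimension two the amplitude at `(j N, 1)` has to be a multiple of `(-1, j N)`. -/
lemma isLadder_two (N : ℕ) (β : ℝ) :
    IsLadder (d := 2) 0 1 N β (1 / √(1 + (N : ℝ) ^ 2))
      ((1 + 2 * (N : ℝ) ^ 2) / (√(1 + (N : ℝ) ^ 2) * √(1 + 4 * (N : ℝ) ^ 2)))
      fun j => (![β, -1, 1, 1, β] j / √(1 + (((j : ℕ) : ℝ) - 2) ^ 2 * (N : ℝ) ^ 2)) •
        ![-1, (((j : ℕ) : ℝ) - 2) * N] where
  div_free j := by
    simp only [Pi.smul_apply, smul_eq_mul, Matrix.cons_val_zero, Matrix.cons_val_one]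
    ring
  outer j hj := by
    have h : √(1 + 4 * (N : ℝ) ^ 2) ^ 2 = 1 + 4 * (N : ℝ) ^ 2 := Real.sq_sqrt (by positivity)
    have h' : 0 < √(1 + 4 * (N : ℝ) ^ 2) := by positivity
    rcases hj with rfl | rfl <;>
      norm_num [dotProduct, Fin.sum_univ_two, vec_two, vec_three, vec_four] <;>
      field_simp <;> rw [h] <;> ring
  inner j hj := by
    have h : √(1 + (N : ℝ) ^ 2) ^ 2 = 1 + (N : ℝ) ^ 2 := Real.sq_sqrt (by positivity)
    have h' : 0 < √(1 + (N : ℝ) ^ 2) := by positivity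
    rcases hj with rfl | rfl | rfl <;>
      norm_num [dotProduct, Fin.sum_univ_two, vec_two, vec_three, vec_four] <;>
      field_simp <;> rw [h]
  dot01 := by
    norm_num [dotProduct, Fin.sum_univ_two, vec_two, vec_three, vec_four]
    field_simp
    ring
  dot12 := by
    norm_num [dotProduct, Fin.sum_univ_two, vec_two, vec_three, vec_four]
    ring
  dot23 := by norm_num [dotProduct, Fin.sum_univ_two, vec_two, vec_three, vec_four]
  dot34 := by
    norm_num [dotProduct, Fin.sum_univ_two, vec_two, vec_three, vec_four]
    field_simp

/-- A lower bound for the cosine of the angle between the vectors `(1, N)` and `(1, 2 N)`, where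
`t = N ^ 2`; it is attained at `N = 1`. -/
lemma three_div_sqrt_ten_le {t : ℝ} (ht : 1 ≤ t) :
    3 / √10 ≤ (1 + 2 * t) / (√(1 + t) * √(1 + 4 * t)) := by
  rw [← Real.sqrt_mul (by positivity), div_le_div_iff₀ (by positivity) (by positivity)]
  refine abs_le_of_sq_le_sq' ?_ (by positivity) |>.2
  rw [mul_pow, mul_pow, Real.sq_sqrt (by positivity), Real.sq_sqrt (by positivity)]
  nlinarith

/-- In dimension two, the contribution of the pairs of modes `j = ±1, ±2` to the rescaled
numerator, with the cosine replaced by its lower bound `3 / √10`, dominates the corresponding terms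
of the explicit bound; equality holds at `x = 1`. -/
lemma outer_modes_le {p x : ℝ} (hp : 2 ≤ p) (hx : 0 < x) (hx1 : x ≤ 1) :
    x / √((1 + x) * (1 + 4 * x)) *
        (15 * (1 + x / 4) ^ (p - 1) * 2 ^ (p - 2) - (1 + x) ^ (p - 1) * (3 / 2 ^ (p - 1))) ≤
      3 / √10 * (2 ^ p * (1 + x / 4) ^ p - 2 ^ (-p) * (1 + x) ^ p) := by
  set U : ℝ := 2 ^ p * (1 + x / 4) ^ (p - 1) with hU
  set V : ℝ := 2 ^ (-p) * (1 + x) ^ (p - 1) with hV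
  have hV0 : 0 < V := by positivity
  have e1 : 15 * (1 + x / 4) ^ (p - 1) * 2 ^ (p - 2) = 15 / 4 * U := by
    rw [hU, Real.rpow_sub two_pos, Real.rpow_two]; ring
  have e2 : (1 + x) ^ (p - 1) * (3 / 2 ^ (p - 1)) = 6 * V := by
    rw [hV, Real.rpow_sub_one two_ne_zero p, Real.rpow_neg zero_le_two]; field_simp; norm_num
  have e3 : 2 ^ p * (1 + x / 4) ^ p = U * (1 + x / 4) := by
    rw [hU, mul_assoc, ← Real.rpow_add_one (by positivity), sub_add_cancel]
  have e4 : 2 ^ (-p) * (1 + x) ^ p = V * (1 + x) := by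
    rw [hV, mul_assoc, ← Real.rpow_add_one (by positivity), sub_add_cancel]
  rw [e1, e2, e3, e4]
  have hUV : 10 * V ≤ U := by
    -- `1 + x / 4 ≥ (5 / 8) (1 + x)` as `x ≤ 1`
    have h1 : (5 / 8 * (1 + x)) ^ (p - 1) ≤ (1 + x / 4) ^ (p - 1) :=
      Real.rpow_le_rpow (by positivity) (by linarith) (by linarith)
    rw [Real.mul_rpow (by norm_num) (by positivity)] at h1
    have h2 : (5 / 2 : ℝ) ≤ (5 / 2) ^ (p - 1) :=
      Real.self_le_rpow_of_one_le (by norm_num) (by linarith)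
    have h3 : (10 : ℝ) * 2 ^ (-p) ≤ 2 ^ p * (5 / 8) ^ (p - 1) := by
      have e : (5 / 2 : ℝ) ^ (p - 1) = 2 ^ p * 2 ^ p / 4 * (5 / 8) ^ (p - 1) := by
        rw [show (5 / 2 : ℝ) = 2 * (2 * (5 / 8)) by norm_num,
          Real.mul_rpow zero_le_two (by norm_num), Real.mul_rpow zero_le_two (by norm_num),
          Real.rpow_sub_one two_ne_zero]
        ring
      rw [e] at h2
      rw [Real.rpow_neg zero_le_two, ← div_eq_mul_inv, div_le_iff₀ (by positivity)]
      linarith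
    calc 10 * V = 10 * 2 ^ (-p) * (1 + x) ^ (p - 1) := by rw [hV]; ring
      _ ≤ 2 ^ p * (5 / 8) ^ (p - 1) * (1 + x) ^ (p - 1) := by gcongr
      _ = 2 ^ p * ((5 / 8) ^ (p - 1) * (1 + x) ^ (p - 1)) := by ring
      _ ≤ _ := by rw [hU]; gcongr
  have h10 : 0 < √(10 : ℝ) := by positivity
  -- `y` is normalised so that `y = 1`, and the next estimate is an equality, at `x = 1`
  set y := x * √10 / √((1 + x) * (1 + 4 * x)) with hy
  have hy1 : y ≤ (4 + x) / 5 := by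
    rw [hy, div_le_div_iff₀ (by positivity) (by norm_num)]
    refine abs_le_of_sq_le_sq' ?_ (by positivity) |>.2
    rw [mul_pow, mul_pow, mul_pow, Real.sq_sqrt (by positivity), Real.sq_sqrt (by positivity)]
    -- the difference of the squared sides, which vanishes at `x = 1`
    have : 0 ≤ (1 - x) * (16 + 104 * x - 41 * x ^ 2 - 4 * x ^ 3) := by
      refine mul_nonneg (by linarith) ?_
      nlinarith [pow_le_one₀ hx.le hx1 (n := 2), pow_le_one₀ hx.le hx1 (n := 3), pow_pos hx 2]
    nlinarith
  have hxy : x / √((1 + x) * (1 + 4 * x)) = y / √10 := by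
    rw [hy]; field_simp
  rw [hxy, div_mul_eq_mul_div y, div_mul_eq_mul_div (3 : ℝ), div_le_div_iff_of_pos_right h10]
  have h5 : 0 ≤ (U - 10 * V) * (4 + x - 5 * y) :=
    mul_nonneg (by linarith) (by linarith)
  have h6 : 0 ≤ V * (27 + 9 / 2 * x - 63 / 2 * y) := mul_nonneg hV0.le (by linarith)
  linarith

/-- In dimension two, the contribution of the pairs of modes `j = 0, ±1` to the rescaled numerator
dominates the corresponding terms of the explicit bound. -/
lemma inner_modes_le {p x s : ℝ} (hp : 1 / 2 ≤ p) (hx : 0 < x) (hx1 : x ≤ 1) (hs : 1 ≤ s) :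
    x / √(1 + x) * (2 * (1 + x) ^ (p - 1) - x ^ (p - 1)) ≤
      √x / √(s + x) * ((s + x) ^ p - x ^ p) := by
  have hsx : √x * √x = x := Real.mul_self_sqrt hx.le
  have hsx1 : √x ≤ 1 := Real.sqrt_le_one.mpr hx1
  have hsx0 : 0 ≤ √x := Real.sqrt_nonneg x
  have e1 : (1 + x) ^ p = (1 + x) * (1 + x) ^ (p - 1) := by
    rw [mul_comm, ← Real.rpow_add_one (by positivity), sub_add_cancel]
  have e2 : x ^ p = x * x ^ (p - 1) := by
    rw [mul_comm, ← Real.rpow_add_one hx.ne', sub_add_cancel]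
  calc x / √(1 + x) * (2 * (1 + x) ^ (p - 1) - x ^ (p - 1))
      = (x * 2 * (1 + x) ^ (p - 1) - x * x ^ (p - 1)) / √(1 + x) := by ring
    _ ≤ (√x * (1 + x) ^ p - √x * x ^ p) / √(1 + x) := by
      gcongr ?_ / _
      have h1 : x * 2 ≤ √x * (1 + x) := by nlinarith [sq_nonneg (√x - 1)]
      have h2 := mul_le_mul_of_nonneg_right h1 (show 0 ≤ (1 + x) ^ (p - 1) by positivity)
      have h3 : √x * x ^ p ≤ 1 * x ^ p := by gcongr
      rw [e1]
      linarith
    _ = √x * ((1 + x) ^ (p - 1 / 2) - x ^ p / √(1 + x)) := by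
      rw [Real.rpow_sub (by positivity), ← Real.sqrt_eq_rpow]; ring
    _ ≤ √x * ((s + x) ^ (p - 1 / 2) - x ^ p / √(s + x)) := by
      gcongr
    _ = _ := by
      rw [Real.rpow_sub (by positivity), ← Real.sqrt_eq_rpow]; ring

lemma lowerGTwo_le_of_katoBound {p n C : ℝ} (hn : 2 < n) (hp : n ≤ p)
    (hC : KatoBound 2 p n C) : lowerGTwo p n ≤ C := by
  have hn0 : 0 < n := by linarith
  have hp0 : 0 < p := by linarith
  have hx : 0 < n / p := by positivity
  have hx1 : n / p ≤ 1 := (div_le_one hp0).mpr hp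
  have hs := one_le_mul_waveNumber_sq hn0 hp0
  have hN : 1 ≤ (waveNumber p n : ℝ) ^ 2 := by
    have : (1 : ℝ) ≤ waveNumber p n := by
      exact_mod_cast Nat.one_le_iff_ne_zero.mpr (waveNumber_ne_zero hn0 hp0)
    exact one_le_pow₀ this
  have hδ := three_div_sqrt_ten_le hN
  set N := waveNumber p n
  set γ := 1 / √(1 + (N : ℝ) ^ 2) with hγ
  set δ := (1 + 2 * (N : ℝ) ^ 2) / (√(1 + (N : ℝ) ^ 2) * √(1 + 4 * (N : ℝ) ^ 2))
  have hx4 : n / (4 * p) = n / p / 4 := by field_simp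
  have hx5 : 4 * n / p = 4 * (n / p) := by field_simp
  have hγ' : γ = √(n / p) / √(n / p * (N : ℝ) ^ 2 + n / p) := by
    rw [show n / p * (N : ℝ) ^ 2 + n / p = n / p * (1 + (N : ℝ) ^ 2) by ring,
      Real.sqrt_mul hx.le, hγ]
    have : 0 < √(n / p) := Real.sqrt_pos.mpr hx
    field_simp
  have hD := denomFn_pos hn0 hp0
  set x := n / p with hxdef
  set s := x * (N : ℝ) ^ 2 with hsdef
  have hmono := rpow_sub_rpow_mono hp0.le hx hs
  have h2 : (0 : ℝ) < 2 ^ (-p) := by positivity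
  have hdiff : 0 ≤ (4 + x) ^ p - (1 + x) ^ p :=
    sub_nonneg.mpr (Real.rpow_le_rpow (by positivity) (by linarith) hp0.le)
  have h0 : 0 ≤ ladderNum p x s γ δ := by
    have h5 : 0 ≤ (s + x) ^ p - x ^ p :=
      sub_nonneg.mpr (Real.rpow_le_rpow hx.le (by linarith) hp0.le)
    have h6 := hdiff.trans hmono
    unfold ladderNum
    positivity
  have hin := inner_modes_le (p := p) (by linarith) hx hx1 hs
  have hout := outer_modes_le (p := p) (by linarith) hx hx1
  have hbound : x / √((1 + x) * (1 + 4 * x)) *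
      (15 * (1 + x / 4) ^ (p - 1) * 2 ^ (p - 2)
        + (1 + x) ^ (p - 1) * (2 * √(1 + 4 * x) - 3 / 2 ^ (p - 1))
        - √(1 + 4 * x) * x ^ (p - 1)) ≤ ladderNum p x s γ δ := by
    have h7 : 2 ^ (-p) * (3 / √10) * ((4 + x) ^ p - (1 + x) ^ p) ≤
        2 ^ (-p) * δ * ((4 * s + x) ^ p - (s + x) ^ p) := by gcongr
    have h8 := two_rpow_neg_mul_four_add_rpow (p := p) hx
    have hq : 0 < √(1 + 4 * x) := by positivity
    calc _ = x / √(1 + x) * (2 * (1 + x) ^ (p - 1) - x ^ (p - 1)) +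
        x / √((1 + x) * (1 + 4 * x)) *
        (15 * (1 + x / 4) ^ (p - 1) * 2 ^ (p - 2) - (1 + x) ^ (p - 1) * (3 / 2 ^ (p - 1))) := by
          rw [Real.sqrt_mul (by positivity)]
          field_simp
          ring
      _ ≤ √x / √(s + x) * ((s + x) ^ p - x ^ p) +
        3 / √10 * (2 ^ p * (1 + x / 4) ^ p - 2 ^ (-p) * (1 + x) ^ p) := add_le_add hin hout
      _ = γ * ((s + x) ^ p - x ^ p) + 2 ^ (-p) * (3 / √10) * ((4 + x) ^ p - (1 + x) ^ p) := by
          rw [hγ', ← h8]; ring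
      _ ≤ _ := by unfold ladderNum; gcongr
  refine le_trans ?_ (hC.ladderNum_le hn0 hp0 (by decide) (isLadder_two N _) h0)
  have hpi : √2 * (2 * Real.pi) ^ (-(((2 : ℕ) : ℝ) / 2)) = 1 / (√2 * Real.pi) := by
    have := Real.mul_self_sqrt zero_le_two
    have := Real.pi_pos
    rw [Nat.cast_ofNat, div_self two_ne_zero, Real.rpow_neg_one]
    field_simp
    linarith
  rw [hpi, lowerGTwo, ← hxdef, hx4, hx5, ← mul_div_assoc, Real.rpow_add_one hx.ne']
  gcongr ?_ / _
  calc _ = 1 / (√2 * Real.pi) * x ^ (n / 2) * (x / √((1 + x) * (1 + 4 * x)) *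
      (15 * (1 + x / 4) ^ (p - 1) * 2 ^ (p - 2)
        + (1 + x) ^ (p - 1) * (2 * √(1 + 4 * x) - 3 / 2 ^ (p - 1))
        - √(1 + 4 * x) * x ^ (p - 1))) := by
        have := Real.pi_pos
        field_simp
    _ ≤ _ := by gcongr

lemma coe_le_sharpG {d : ℕ} {p n G : ℝ} (h : ∀ C, KatoBound d p n C → G ≤ C) :
    (G : EReal) ≤ sharpG d p n := by
  refine le_sInf ?_
  rintro _ ⟨C, hC, rfl⟩
  exact_mod_cast h C hC

/-! ### Asymptotics -/

/-- The second-order expansion of `log (1 + b y + a y^2)` at `y = 0`. -/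
lemma tendsto_log_expansion (a b : ℝ) :
    Tendsto (fun y : ℝ => (Real.log (1 + b * y + a * y ^ 2) - b * y) / y ^ 2) (𝓝[≠] 0)
      (𝓝 (a - b ^ 2 / 2)) := by
  set u : ℝ → ℝ := fun y => b * y + a * y ^ 2 with hu
  have hu0 : Tendsto u (𝓝[≠] 0) (𝓝 0) := by
    have : Continuous u := by fun_prop
    simpa [hu] using (this.tendsto 0).mono_left nhdsWithin_le_nhds
  have hsmall : ∀ᶠ y in 𝓝[≠] (0 : ℝ), |u y| < 1 := by
    have := hu0.abs
    rw [abs_zero] at this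
    exact this.eventually_lt_const one_pos
  have hne : ∀ᶠ y in 𝓝[≠] (0 : ℝ), y ≠ 0 := self_mem_nhdsWithin
  have hrem : Tendsto (fun y => (Real.log (1 + u y) - u y + u y ^ 2 / 2) / y ^ 2) (𝓝[≠] 0)
      (𝓝 0) := by
    have hb : Tendsto (fun y : ℝ => |y| * |b + a * y| ^ 3 / (1 - |u y|)) (𝓝[≠] 0) (𝓝 0) := by
      have h1 : Tendsto (fun y : ℝ => |y| * |b + a * y| ^ 3) (𝓝[≠] 0) (𝓝 0) := by
        have : Continuous fun y : ℝ => |y| * |b + a * y| ^ 3 := by fun_prop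
        simpa using (this.tendsto 0).mono_left nhdsWithin_le_nhds
      have h2 : Tendsto (fun y : ℝ => 1 - |u y|) (𝓝[≠] 0) (𝓝 1) := by
        simpa using (tendsto_const_nhds (x := (1 : ℝ))).sub hu0.abs
      have := h1.div h2 one_ne_zero
      rwa [zero_div] at this
    refine squeeze_zero_norm' ?_ hb
    filter_upwards [hsmall, hne] with y hy hy0
    have := Real.abs_log_sub_add_sum_range_le (x := -u y) (by rwa [abs_neg]) 2
    rw [Finset.sum_range_succ, Finset.sum_range_one, sub_neg_eq_add, abs_neg] at this
    have e : Real.log (1 + u y) - u y + u y ^ 2 / 2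
        = (-u y) ^ (0 + 1) / ((0 : ℕ) + 1) + (-u y) ^ (1 + 1) / ((1 : ℕ) + 1)
          + Real.log (1 + u y) := by push_cast; ring
    have e2 : |u y| = |y| * |b + a * y| := by rw [← abs_mul, hu]; congr 1; ring
    have hy2 : 0 < |y| := abs_pos.mpr hy0
    rw [Real.norm_eq_abs, abs_div, abs_pow, div_le_iff₀ (by positivity), e]
    refine this.trans (le_of_eq ?_)
    nth_rewrite 1 [e2]
    ring
  have hmain : Tendsto (fun y : ℝ => a - (b + a * y) ^ 2 / 2) (𝓝[≠] 0) (𝓝 (a - b ^ 2 / 2)) := by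
    have : Continuous fun y : ℝ => a - (b + a * y) ^ 2 / 2 := by fun_prop
    simpa using (this.tendsto 0).mono_left nhdsWithin_le_nhds
  have := hrem.add hmain
  rw [zero_add] at this
  refine this.congr' ?_
  filter_upwards [hne] with y hy
  simp only [hu, ← add_assoc]
  field_simp
  ring

lemma tendsto_const_div_atTop_nhds_zero (n : ℝ) : Tendsto (fun p : ℝ => n / p) atTop (𝓝 0) :=
  tendsto_const_nhds.div_atTop tendsto_id

lemma tendsto_sqrt_div (n : ℝ) : Tendsto (fun p : ℝ => √(n / p)) atTop (𝓝 0) := by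
  simpa using (tendsto_const_div_atTop_nhds_zero n).sqrt

lemma mul_sqrt_div {n p : ℝ} (hp : 0 < p) : p * √(n / p) = √(n * p) := by
  rw [show n * p = p ^ 2 * (n / p) by field_simp, Real.sqrt_mul (by positivity),
    Real.sqrt_sq hp.le]

/-- The exponential asymptotics of all the powers in `denomFn` and in the numerators: it is the
expansion of the logarithm at `y = √(n / p)`, where `p = n / y ^ 2`. -/
lemma tendsto_rpow_div_exp {n : ℝ} (hn : 0 < n) (a b : ℝ) :
    Tendsto (fun p : ℝ => (1 + b * √(n / p) + a * (n / p)) ^ p / Real.exp (b * √(n * p))) atTop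
      (𝓝 (Real.exp ((a - b ^ 2 / 2) * n))) := by
  have hy : Tendsto (fun p : ℝ => √(n / p)) atTop (𝓝[≠] 0) := by
    refine tendsto_nhdsWithin_of_tendsto_nhds_of_eventually_within _ (tendsto_sqrt_div n) ?_
    filter_upwards [eventually_gt_atTop 0] with p hp
    exact (Real.sqrt_pos.mpr (by positivity)).ne'
  have h1 := (((tendsto_log_expansion a b).comp hy).mul_const n).rexp
  have hpos : ∀ᶠ p : ℝ in atTop, 0 < 1 + b * √(n / p) + a * (n / p) := by
    have : Tendsto (fun p : ℝ => 1 + b * √(n / p) + a * (n / p)) atTop (𝓝 1) := by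
      simpa using (((tendsto_sqrt_div n).const_mul b).const_add 1).add
        ((tendsto_const_div_atTop_nhds_zero n).const_mul a)
    exact this.eventually_const_lt one_pos
  refine h1.congr' ?_
  filter_upwards [hpos, eventually_gt_atTop 0] with p hp hp0
  have hx : √(n / p) ^ 2 = n / p := Real.sq_sqrt (by positivity)
  simp only [Function.comp_apply]
  rw [hx, Real.rpow_def_of_pos hp, ← Real.exp_sub, ← mul_sqrt_div hp0]
  congr 1
  field_simp

lemma tendsto_one_add_mul_div_rpow {n : ℝ} (hn : 0 < n) (a : ℝ) :
    Tendsto (fun p : ℝ => (1 + a * (n / p)) ^ p) atTop (𝓝 (Real.exp (a * n))) := by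
  simpa using tendsto_rpow_div_exp hn a 0

lemma tendsto_div_rpow_sub {n : ℝ} (hn : 0 < n) (c : ℝ) :
    Tendsto (fun p : ℝ => (n / p) ^ (p - c)) atTop (𝓝 0) := by
  refine squeeze_zero' ?_ ?_ (tendsto_const_div_atTop_nhds_zero n)
  · filter_upwards [eventually_gt_atTop 0] with p hp
    positivity
  · filter_upwards [eventually_gt_atTop 0, eventually_ge_atTop n, eventually_ge_atTop (1 + c)]
      with p hp hpn hpc
    simpa using Real.rpow_le_rpow_of_exponent_ge (by positivity) ((div_le_one hp).mpr hpn)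
      (show 1 ≤ p - c by linarith)

lemma tendsto_exp_neg_mul_sqrt {n : ℝ} (hn : 0 < n) :
    Tendsto (fun p : ℝ => (Real.exp (2 * √(n * p)))⁻¹) atTop (𝓝 0) :=
  (Real.tendsto_exp_atTop.comp ((Real.tendsto_sqrt_atTop.comp
    (tendsto_id.const_mul_atTop hn)).const_mul_atTop two_pos)).inv_tendsto_atTop

lemma tendsto_two_rpow_inv : Tendsto (fun p : ℝ => ((2 : ℝ) ^ p)⁻¹) atTop (𝓝 0) :=
  (tendsto_rpow_atTop_of_base_gt_one 2 one_lt_two).inv_tendsto_atTop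

lemma tendsto_sigmaFn {n : ℝ} (hn : 0 < n) :
    Tendsto (fun p : ℝ => sigmaFn p n / Real.exp (2 * √(n * p))) atTop
      (𝓝 (Real.exp (-(3 * n / 4)) + 1)) := by
  have h1 := tendsto_rpow_div_exp hn (5 / 4) 2
  have h2 := tendsto_rpow_div_exp hn 2 2
  have h3 := ((tendsto_div_rpow_sub hn 0).const_mul (1 / 2)).mul (tendsto_exp_neg_mul_sqrt hn)
  have := (h1.add h2).add h3
  convert! this using 1
  · funext p
    rw [sigmaFn, show 5 * n / (4 * p) = 5 / 4 * (n / p) by ring, mul_div_assoc 2 n p, sub_zero]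
    ring
  · congr 1
    norm_num
    ring

lemma tendsto_upsilonFn {n : ℝ} (hn : 0 < n) :
    Tendsto (fun p : ℝ => upsilonFn p n) atTop (𝓝 1) := by
  have hx := tendsto_const_div_atTop_nhds_zero n
  have hs := tendsto_sqrt_div n
  have h : ∀ a : ℝ, Tendsto (fun p : ℝ => (1 + 2 * √(n / p) + a * (n / p)) ^ n) atTop (𝓝 1) := by
    intro a
    have : Tendsto (fun p : ℝ => 1 + 2 * √(n / p) + a * (n / p)) atTop (𝓝 1) := by
      simpa using ((hs.const_mul 2).const_add 1).add (hx.const_mul a)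
    simpa using this.rpow_const (p := n) (Or.inl one_ne_zero)
  have h2 : Tendsto (fun p : ℝ => 1 / (2 : ℝ) ^ (2 * p - 2 * n)) atTop (𝓝 0) := by
    simp_rw [one_div]
    exact tendsto_two_rpow_inv.comp
      (tendsto_atTop_add_const_right _ _ (tendsto_id.const_mul_atTop two_pos))
  have h3 : Tendsto (fun p : ℝ => 1 / 2 * (n / p) ^ n) atTop (𝓝 0) := by
    have := (hx.rpow_const (p := n) (Or.inr hn.le)).const_mul (1 / 2)
    rwa [Real.zero_rpow hn.ne', mul_zero] at this
  have := ((h 2).add (h2.mul (h (5 / 4)))).add h3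
  convert! this using 1
  · funext p
    rw [upsilonFn, show 5 * n / (4 * p) = 5 / 4 * (n / p) by ring, mul_div_assoc 2 n p]
  · norm_num

lemma tendsto_denomFn {n : ℝ} (hn : 0 < n) :
    Tendsto (fun p : ℝ => denomFn p n / Real.exp (2 * √(n * p))) atTop
      (𝓝 ((Real.exp (-(n / 2)) + √(Real.exp (-(3 * n / 4)) + 1))
        * √(Real.exp (-(3 * n / 4)) + 1))) := by
  have h1 : Tendsto (fun p : ℝ => (1 + √(n / p)) ^ p / Real.exp √(n * p)) atTop
      (𝓝 (Real.exp (-(n / 2)))) := by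
    have := tendsto_rpow_div_exp hn 0 1
    simp only [one_mul, zero_mul, add_zero] at this
    convert! this using 3
    ring
  have h2 : Tendsto (fun p : ℝ => (1 + √(n / p)) ^ n) atTop (𝓝 1) := by
    have : Tendsto (fun p : ℝ => 1 + √(n / p)) atTop (𝓝 1) := by
      simpa using (tendsto_sqrt_div n).const_add 1
    simpa using this.rpow_const (p := n) (Or.inl one_ne_zero)
  have h3 := (tendsto_sigmaFn hn).sqrt
  have h4 := (tendsto_upsilonFn hn).sqrt
  have := ((h1.mul h4).add (h2.mul h3)).mul h3
  rw [Real.sqrt_one, mul_one, one_mul] at this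
  refine this.congr fun p => ?_
  have e : Real.exp (2 * √(n * p)) = Real.exp √(n * p) ^ 2 := by
    rw [← Real.exp_nat_mul]; norm_num
  rw [denomFn, e, Real.sqrt_div' _ (sq_nonneg _), Real.sqrt_sq (by positivity)]
  field_simp

lemma asympConst_eq (n : ℝ) :
    asympConst n = Real.exp (n / 4) / ((Real.exp (-(n / 2)) + √(Real.exp (-(3 * n / 4)) + 1))
        * √(Real.exp (-(3 * n / 4)) + 1)) := by
  set E := Real.exp (n / 8) with hE
  have hE0 : 0 < E := Real.exp_pos _
  have e1 : Real.exp (9 * n / 8) = E ^ 9 := by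
    rw [hE, ← Real.exp_nat_mul]; congr 1; push_cast; ring
  have e2 : Real.exp (3 * n / 4) = E ^ 6 := by
    rw [hE, ← Real.exp_nat_mul]; congr 1; push_cast; ring
  have e3 : Real.exp (n / 4) = E ^ 2 := by
    rw [hE, ← Real.exp_nat_mul]; congr 1; push_cast; ring
  have e4 : Real.exp (-(n / 2)) = (E ^ 4)⁻¹ := by
    rw [hE, ← Real.exp_nat_mul, ← Real.exp_neg]; congr 1; push_cast; ring
  have e5 : √(1 + E ^ 6) = E ^ 3 * √((E ^ 6)⁻¹ + 1) := by
    rw [show 1 + E ^ 6 = (E ^ 3) ^ 2 * ((E ^ 6)⁻¹ + 1) by field_simp,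
      Real.sqrt_mul (by positivity), Real.sqrt_sq (by positivity)]
  have hs : 0 < √((E ^ 6)⁻¹ + 1) := by positivity
  rw [asympConst, ← hE, Real.exp_neg (3 * n / 4), e1, e2, e3, e4, e5]
  generalize √((E ^ 6)⁻¹ + 1) = S at hs
  field_simp

/-- The common step of the two expansions: `K` is the limit of the prefactor and `R` that of the
numerator divided by `2 ^ p`. -/
lemma isEquivalent_lowerBound {n : ℝ} (hn : 0 < n) {α R K : ℝ} {k num : ℝ → ℝ} (hR : R ≠ 0)
    (hK : K ≠ 0) (hk : Tendsto k atTop (𝓝 K))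
    (hnum : Tendsto (fun p => num p / 2 ^ p) atTop (𝓝 (R * Real.exp (n / 4)))) :
    (fun p : ℝ => k p * (n / p) ^ α * (num p / denomFn p n)) ~[atTop]
      fun p => K * R * asympConst n * (n / p) ^ α * ((2 : ℝ) ^ p / Real.exp (2 * √(n * p))) := by
  have hlim := (hk.mul hnum).div (tendsto_denomFn hn) (by positivity)
  have heq : K * (R * Real.exp (n / 4)) / ((Real.exp (-(n / 2)) + √(Real.exp (-(3 * n / 4)) + 1))
      * √(Real.exp (-(3 * n / 4)) + 1)) = K * R * asympConst n := by
    rw [asympConst_eq]; ring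
  rw [heq] at hlim
  have hc : K * R * asympConst n ≠ 0 := by
    have : 0 < asympConst n := by unfold asympConst; positivity
    positivity
  have h1 := (isEquivalent_const_iff_tendsto hc).mpr hlim
  have h2 := h1.mul (IsEquivalent.refl (l := atTop)
    (u := fun p : ℝ => (n / p) ^ α * ((2 : ℝ) ^ p / Real.exp (2 * √(n * p)))))
  refine (h2.congr_left ?_).congr_right ?_
  · filter_upwards with p
    simp only [Pi.mul_apply, Pi.div_apply]
    field_simp
  · filter_upwards with p
    simp only [Pi.mul_apply, Function.const_apply]
    ring

/-- Any function with this asymptotic behaviour has `p`-th root tending to `2`, the other factors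
being subexponential in `p`. -/
lemma tendsto_rpow_one_div_of_isEquivalent {n : ℝ} (hn : 0 < n) {α K : ℝ} (hK : 0 < K)
    {f : ℝ → ℝ} (hf : f ~[atTop]
      fun p => K * (n / p) ^ α * ((2 : ℝ) ^ p / Real.exp (2 * √(n * p)))) :
    Tendsto (fun p => f p ^ (1 / p)) atTop (𝓝 2) := by
  set g : ℝ → ℝ := fun p => K * (n / p) ^ α * ((2 : ℝ) ^ p / Real.exp (2 * √(n * p))) with hg
  have hg0 : ∀ᶠ p : ℝ in atTop, 0 < g p := by
    filter_upwards [eventually_gt_atTop 0] with p hp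
    rw [hg]
    positivity
  have hfg : Tendsto (fun p => f p / g p) atTop (𝓝 1) :=
    (isEquivalent_iff_tendsto_one (hg0.mono fun p h => h.ne')).mp hf
  have hinv : Tendsto (fun p : ℝ => p⁻¹) atTop (𝓝 0) := tendsto_inv_atTop_zero
  have hlogfg := (hfg.log one_ne_zero).mul hinv
  have hlogp : Tendsto (fun p : ℝ => Real.log p / p) atTop (𝓝 0) := by
    simpa using Real.isLittleO_log_id_atTop.tendsto_div_nhds_zero
  have h1 := (((hinv.const_mul (Real.log K + α * Real.log n)).sub (hlogp.const_mul α)).add_const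
    (Real.log 2)).sub ((tendsto_sqrt_div n).const_mul 2)
  have h2 := (hlogfg.add h1).rexp
  simp only [mul_zero, sub_zero, zero_add, Real.exp_log two_pos] at h2
  refine h2.congr' ?_
  filter_upwards [eventually_gt_atTop 0, hg0, hfg.eventually_const_lt one_pos] with p hp hgp hfgp
  have hfp : 0 < f p := (div_pos_iff_of_pos_right hgp).mp hfgp
  rw [Real.rpow_def_of_pos hfp, Real.log_div hfp.ne' hgp.ne']
  congr 1
  have hlogg : Real.log (g p)
      = Real.log K + α * (Real.log n - Real.log p) + (p * Real.log 2 - 2 * (p * √(n / p))) := by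
    rw [mul_sqrt_div hp]
    simp only [hg]
    rw [Real.log_mul (by positivity) (by positivity), Real.log_mul (by positivity) (by positivity),
      Real.log_rpow (by positivity), Real.log_div hn.ne' hp.ne',
      Real.log_div (by positivity) (by positivity), Real.log_exp, Real.log_rpow two_pos]
  rw [hlogg]
  field_simp
  ring

lemma asympConst_pos (n : ℝ) : 0 < asympConst n := by
  unfold asympConst; positivity

lemma isEquivalent_lowerG (d : ℕ) {n : ℝ} (hn : 0 < n) :
    (fun p : ℝ => lowerG d p n) ~[atTop]
        (fun p : ℝ => √2 / (2 * Real.pi) ^ ((d : ℝ) / 2) * asympConst n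
          * (n / p) ^ (n / 2) * ((2 : ℝ) ^ p / Real.exp (2 * √(n * p)))) := by
  have h1 := tendsto_one_add_mul_div_rpow hn (1 / 4)
  have h2 := tendsto_one_add_mul_div_rpow hn 1
  have h3 := tendsto_two_rpow_inv
  have h4 := tendsto_div_rpow_sub hn 0
  have hnum : Tendsto (fun p : ℝ => ((1 + n / (4 * p)) ^ p * 2 ^ p
      + (1 - 1 / 2 ^ p) * (1 + n / p) ^ p - (n / p) ^ p) / 2 ^ p) atTop
      (𝓝 (1 * Real.exp (n / 4))) := by
    have := (h1.add ((((h3.const_sub 1).mul h2).mul h3))).sub (h4.mul h3)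
    convert! this using 1
    · funext p
      rw [show n / (4 * p) = 1 / 4 * (n / p) by ring, sub_zero, one_mul]
      field_simp
    · congr 1
      norm_num
      ring_nf
  have hK : √2 / (2 * Real.pi) ^ ((d : ℝ) / 2) ≠ 0 := by positivity
  simpa only [mul_one, lowerG] using
    isEquivalent_lowerBound hn (α := n / 2) one_ne_zero hK tendsto_const_nhds hnum

lemma isEquivalent_lowerGTwo {n : ℝ} (hn : 0 < n) :
    (fun p : ℝ => lowerGTwo p n) ~[atTop]
        (fun p : ℝ => 15 / (4 * √2 * Real.pi) * asympConst n
          * (n / p) ^ (n / 2 + 1) * ((2 : ℝ) ^ p / Real.exp (2 * √(n * p)))) := by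
  have hx := tendsto_const_div_atTop_nhds_zero n
  have h1 := tendsto_one_add_mul_div_rpow hn (1 / 4)
  have h2 := tendsto_one_add_mul_div_rpow hn 1
  have h3 := tendsto_two_rpow_inv
  have h4 := tendsto_div_rpow_sub hn 1
  have hlin : ∀ a : ℝ, Tendsto (fun p : ℝ => 1 + a * (n / p)) atTop (𝓝 1) := by
    intro a
    simpa using (hx.const_mul a).const_add 1
  have h5 := (hlin 4).sqrt
  rw [Real.sqrt_one] at h5
  have hnum : Tendsto (fun p : ℝ => (15 * (1 + n / (4 * p)) ^ (p - 1) * 2 ^ (p - 2)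
        + (1 + n / p) ^ (p - 1) * (2 * √(1 + 4 * n / p) - 3 / 2 ^ (p - 1))
        - √(1 + 4 * n / p) * (n / p) ^ (p - 1)) / 2 ^ p) atTop
      (𝓝 (15 / 4 * Real.exp (n / 4))) := by
    have := (((h1.div (hlin (1 / 4)) one_ne_zero).const_mul (15 / 4)).add
      (((h2.div (hlin 1) one_ne_zero).mul ((h5.const_mul 2).sub (h3.const_mul 6))).mul h3)).sub
      ((h5.mul h4).mul h3)
    have hlim : 15 / 4 * (Real.exp (1 / 4 * n) / 1)
        + Real.exp (1 * n) / 1 * (2 * 1 - 6 * 0) * 0 - 1 * 0 * 0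
        = 15 / 4 * Real.exp (n / 4) := by ring_nf
    rw [hlim] at this
    refine this.congr' ?_
    filter_upwards [eventually_gt_atTop 0] with p hp
    have hq : 0 < n / p := by positivity
    simp only [Pi.div_apply]
    rw [show n / (4 * p) = 1 / 4 * (n / p) by ring, mul_div_assoc 4 n p,
      Real.rpow_sub two_pos p 2, Real.rpow_two, Real.rpow_sub_one two_ne_zero,
      Real.rpow_sub_one (x := 1 + 1 / 4 * (n / p)) (by positivity),
      Real.rpow_sub_one (x := 1 + n / p) (by positivity), one_mul]
    field_simp
    ring
  have hk : Tendsto (fun p : ℝ => 1 / (√2 * Real.pi * √((1 + n / p) * (1 + 4 * n / p)))) atTop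
      (𝓝 (1 / (√2 * Real.pi))) := by
    have h6 := ((hlin 1).mul (hlin 4)).sqrt
    rw [mul_one, Real.sqrt_one] at h6
    have := (tendsto_const_nhds (x := (1 : ℝ))).div (h6.const_mul (√2 * Real.pi))
      (by have := Real.pi_pos; positivity)
    rw [mul_one] at this
    refine this.congr fun p => ?_
    simp only [Pi.div_apply]
    rw [one_mul, mul_div_assoc 4 n p]
  have hpi := Real.pi_pos
  have := isEquivalent_lowerBound hn (α := n / 2 + 1) (R := 15 / 4) (by norm_num) (by positivity)
    hk hnum
  convert! this using 2 with p p
  · rw [lowerGTwo]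
    ring
  · rw [show 1 / (√2 * Real.pi) * (15 / 4) = 15 / (4 * √2 * Real.pi) by field_simp]

end KatoTorus

end

theorem mainTheorem12 :
    (∀ d : ℕ, 3 ≤ d → ∀ p n : ℝ, n ≤ p → (d : ℝ) / 2 + 1 < n →
      (KatoTorus.lowerG d p n : EReal) ≤ KatoTorus.sharpG d p n) ∧
    (∀ d : ℕ, 3 ≤ d → ∀ n : ℝ, (d : ℝ) / 2 + 1 < n →
      (fun p : ℝ => KatoTorus.lowerG d p n) ~[atTop]
        (fun p : ℝ => √2 / (2 * Real.pi) ^ ((d : ℝ) / 2) * KatoTorus.asympConst n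
          * (n / p) ^ (n / 2) * ((2 : ℝ) ^ p / Real.exp (2 * √(n * p)))) ∧
      Tendsto (fun p : ℝ => KatoTorus.lowerG d p n ^ (1 / p)) atTop (𝓝 2)) ∧
    (∀ p n : ℝ, n ≤ p → 2 < n →
      (KatoTorus.lowerGTwo p n : EReal) ≤ KatoTorus.sharpG 2 p n) ∧
    (∀ n : ℝ, 2 < n →
      (fun p : ℝ => KatoTorus.lowerGTwo p n) ~[atTop]
        (fun p : ℝ => 15 / (4 * √2 * Real.pi) * KatoTorus.asympConst n
          * (n / p) ^ (n / 2 + 1) * ((2 : ℝ) ^ p / Real.exp (2 * √(n * p)))) ∧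
      Tendsto (fun p : ℝ => KatoTorus.lowerGTwo p n ^ (1 / p)) atTop (𝓝 2)) := by
  have hpos : ∀ {d : ℕ} {n : ℝ}, (d : ℝ) / 2 + 1 < n → 0 < n := fun {d n} h => by
    have : (0 : ℝ) ≤ d := Nat.cast_nonneg d
    linarith
  have hpi := Real.pi_pos
  refine ⟨fun d hd p n hp hn => ?_, fun d _ n hn => ?_, fun p n hp hn => ?_, fun n hn => ?_⟩
  · exact KatoTorus.coe_le_sharpG fun C hC =>
      KatoTorus.lowerG_le_of_katoBound hd (hpos hn) ((hpos hn).trans_le hp) hC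
  · have h := KatoTorus.isEquivalent_lowerG d (hpos hn)
    have := KatoTorus.asympConst_pos n
    exact ⟨h, KatoTorus.tendsto_rpow_one_div_of_isEquivalent (hpos hn) (by positivity) h⟩
  · exact KatoTorus.coe_le_sharpG fun C hC => KatoTorus.lowerGTwo_le_of_katoBound hn hp hC
  · have hn0 : 0 < n := by linarith
    have h := KatoTorus.isEquivalent_lowerGTwo hn0
    have := KatoTorus.asympConst_pos n
    exact ⟨h, KatoTorus.tendsto_rpow_one_div_of_isEquivalent hn0 (by positivity) h⟩
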